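/- **Conventions.** For $0<\theta<\pi$, $c>0$ put $\Sigma_{\theta,c}=\{z\in\mathbb C:\ |\arg(z-c)|\le\theta/2\}$ and $AD_{\theta,c}=\mathbb C\setminus\Sigma_{\theta,c}$. All sequences (simple or double) consist of non-zero complex numbers accumulating only at infinity. The exponent $\mathsf e(S)$ is the exponent of convergence and is assumed finite; the genus $\mathsf g(S)$ is the least integer $p\ge 0$ with $\sum_{\lambda\in S}|\lambda|^{-p-1}<\infty$. Put $$\frac1{\Gamma(-\lambda,S)}=\prod_{\mu\in S}\Big(1-\frac{\lambda}{\mu}\Big)\exp\Big(\sum_{j=1}^{\mathsf g(S)}\frac{(-1)^j}{j}\frac{(-\lambda)^j}{\mu^j}\Big).$$ If $S$ is contained in $\Sigma_{\theta,c}$, then $\log\Gamma(-\lambda,S)$ is the analytic branch on $AD_{\theta,c}$ that vanishes at $\lambda=0$. A simple sequence $S$ with $\mathsf e(S)-1<\mathsf g(S)$ is *totally regular of spectral type, with asymptotic domain $AD_{\theta,c}$ and order $\alpha_N$*, if $S$ lies in the interior of $\Sigma_{\theta,c}$ ($c>0$, $0<\theta<\pi$) and, for $\lambda\to\infty$ in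 $AD_{\theta,c}$, $$\log\Gamma(-\lambda,S)=\sum_{j=0}^{N}\sum_{k=0}^{1}a_{\alpha_j,k}(-\lambda)^{\alpha_j}\log^k(-\lambda)+o\big((-\lambda)^{\alpha_N}\big),\qquad \alpha_0>\alpha_1>\dots>\alpha_N\ge-\infty,$$ where $a_{\alpha_j,1}\neq0$ only if $\alpha_j\in\{0,1,2,\dots\}$. Here $N=\infty$ is allowed; then $\alpha_j\to-\infty$, the expansion is meant up to $o((-\lambda)^{\alpha_M})$ for each finite $M$, and the order is $-\infty$. Coefficients may vanish. Let $U=\{u_n\}$ be totally regular of spectral type of order $u'\le0$, with exponent $r_0$ and domain $AD_{\phi,d}$. Let $S=\{\lambda_{n,k}\}$ be a double sequence of finite exponent lying in the interior of $\Sigma_{\theta_0,c_0}$ ($c_0>0$, $0<\theta_0<\pi$), such that the sequences $S_n=\{\lambda_{n,k}\}_k$ all have the same finite exponent and the same genus $p_2$, and the sequences $\{\lambda_{n,k}\}_n$ all have the same finite exponent and the same genus. For $\kappa>0$ and an integer $\ell\ge0$, $S$ is *spectrally decomposable over $U$ with power $\kappa$, length $\ell$ and asymptotic domain $AD_{\theta,c}$*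 if there are $\theta'\in(0,\pi)$ and $c'>0$ with $\theta=\max(\theta_0,\phi,\theta')$, $c=\min(c_0,d,c')$ such that 1. for each $n$, $u_n^{-\kappa}S_n$ lies in the interior of $\Sigma_{\theta',c'}$ and is totally regular of spectral type of order $\le0$ with asymptotic domain $AD_{\theta',c'}$; 2. there are reals $\sigma_0<\dots<\sigma_\ell\le r_0$ and $\rho_0<\dots<\rho_L\le r_0$ with $u'<\min(\sigma_0,\rho_0-1)$, functions $\phi_{\sigma_h}$, and polynomials $P_{\rho_l}$ with $P_{\rho_l}(0)=0$, such that as $n\to\infty$ $$\log\Gamma(-\lambda,u_n^{-\kappa}S_n)=\sum_{h=0}^{\ell}\phi_{\sigma_h}(\lambda)u_n^{-\sigma_h}+\sum_{l=0}^{L}P_{\rho_l}(\lambda)u_n^{-\rho_l}\log u_n+R_n(\lambda),\qquad \sup_{\lambda\in AD_{\theta,c}}\frac{|R_n(\lambda)|}{(1+|\lambda|)^{p_2}}=o(|u_n|^{-r_0}).$$ **Theorem.** Let $S_{(i)}=\{\lambda_{(i),n}\}_{n\ge1}$, $i=1,2$, be totally regular sequences of spectral type with exponents $s_{(i)}$,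 genera $p_{(i)}$, asymptotic domains $AD_{\theta_{(i)},c_{(i)}}$, powers $\alpha_{(i),h}$ and orders $\alpha_{(i),N_{(i)}}$, and let all $\lambda_{(1),n}$ be real. Suppose that $\alpha_{(1),N_{(1)}}<-p_{(2)}-1$ and $-\alpha_{(2),N_{(2)}}\ge s_{(1)}$, that the leading power $\alpha_{(2),0}$ occurs with a non-zero coefficient ($a_{(2),\alpha_{(2),0},0}$ or $a_{(2),\alpha_{(2),0},1}$), and that $-\alpha_{(2),0}\le s_{(1)}$. Then there is a largest integer $\ell$ with $0\le\ell\le N_{(2)}$ and $-\alpha_{(2),\ell}\le s_{(1)}$; and for every $c'\in(0,1)$ the double sequence $\{\lambda_{(1),n_1}+\lambda_{(2),n_2}\}_{n_1,n_2\ge1}$ is spectrally decomposable over $S_{(1)}$ with power $1$, length $\ell$, and asymptotic domain $AD_{\theta,c}$, where $\theta=\max(\theta_{(1)},\theta_{(2)})$ and $c=\min(c_{(1)},c_{(2)},c')$. In particular, if $\min(c_{(1)},c_{(2)})<1$, one may take $c=\min(c_{(1)},c_{(2)})$. -/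

import Mathlib

open Filter Topology Asymptotics Bornology

noncomputable section

/-- The closed sector `Σ_{θ,c} = {z | |arg (z - c)| ≤ θ/2}` (its apex `c` is included, as
`Complex.arg 0 = 0`). -/
def spectralSector (θ c : ℝ) : Set ℂ :=
  {z : ℂ | |Complex.arg (z - (c : ℂ))| ≤ θ / 2}

/-- The open set `AD_{θ,c} = ℂ − Σ_{θ,c}`. -/
def asymptoticDomain (θ c : ℝ) : Set ℂ := (spectralSector θ c)ᶜ

/-- The family `S` has finite exponent of convergence. -/
def FiniteExponent {ι : Type*} (S : ι → ℂ) : Prop :=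
  ∃ r : ℝ, 0 ≤ r ∧ Summable fun i => ‖S i‖ ^ (-r)

/-- The exponent of convergence of a (simple or double) sequence: the infimum of the `r ≥ 0` such
that `∑ |λ|^(-r)` converges. It does not depend on the order of the terms; if the terms are
enumerated by increasing modulus, it is `limsup (log n / log |λ_n|)`. -/
def convExponent {ι : Type*} (S : ι → ℂ) : ℝ :=
  sInf {r : ℝ | 0 ≤ r ∧ Summable fun i => ‖S i‖ ^ (-r)}

/-- The genus: the least integer `p` such that `∑ λ^(-p-1)` converges absolutely. -/
def genus {ι : Type*} (S : ι → ℂ) : ℕ :=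
  sInf {p : ℕ | Summable fun i => (‖S i‖ ^ (p + 1))⁻¹}

/-- `log Γ(-λ, S)`, where
`1 / Γ(-λ, S) = ∏ (1 + (-λ)/λ_n) exp (∑_{j=1}^{p} ((-1)^j / j) ((-λ)/λ_n)^j)`, `p` the genus.
If `S` lies in a sector `Σ_{θ,c}` with `c > 0`, `0 < θ < π`, then for `λ ∉ Σ_{θ,c}` no factor
`1 - λ/λ_n` lies on the cut `(-∞, 0]`, so this is the analytic branch of `log Γ(-λ, S)` on
`AD_{θ,c}` that vanishes at `λ = 0`. -/
def logGamma {ι : Type*} (S : ι → ℂ) (lam : ℂ) : ℂ :=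
  -∑' i, (Complex.log (1 + (-lam) / S i)
    + ∑ j ∈ Finset.Icc 1 (genus S), ((-1 : ℂ) ^ j / (j : ℂ)) * ((-lam) / S i) ^ j)

/-- The powers and the coefficients of an expansion in the functions
`(-λ)^{α_j} log^k (-λ)`, `0 ≤ j ≤ N`, `0 ≤ k ≤ K_j`, with `N` finite or infinite.
The polynomial `a j` collects the coefficients belonging to `α_j`: `a_{α_j,k} = (a j).coeff k`.
Entries with `j > N` are irrelevant. -/
structure ExpansionData where
  N : ℕ∞
  α : ℕ → ℝ
  a : ℕ → Polynomial ℂ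

/-- The order `α_N` of the expansion, with the value `-∞` if `N` is infinite. -/
def ExpansionData.order (E : ExpansionData) : EReal :=
  if E.N = ⊤ then ⊥ else ((E.α E.N.toNat : ℝ) : EReal)

/-- `E` is an asymptotic expansion of `log Γ(-λ, S)` for `λ → ∞` in `AD_{θ,c}`. -/
structure HasLogGammaExpansion (S : ℕ → ℂ) (θ c : ℝ) (E : ExpansionData) : Prop where
  decreasing : ∀ i j : ℕ, i < j → (j : ℕ∞) ≤ E.N → E.α j < E.α i
  infinite : E.N = ⊤ → Tendsto E.α atTop atBot
  isLittleO : ∀ M : ℕ, (M : ℕ∞) ≤ E.N →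
    (fun lam : ℂ => logGamma S lam
      - ∑ j ∈ Finset.range (M + 1),
          (E.a j).eval (Complex.log (-lam)) * (-lam) ^ ((E.α j : ℝ) : ℂ))
      =o[cobounded ℂ ⊓ 𝓟 (asymptoticDomain θ c)] (fun lam : ℂ => ‖lam‖ ^ E.α M)

/-- `S` is a sequence of spectral type with asymptotic domain `AD_{θ,c}` and with the expansion
`E` of `log Γ(-λ, S)`. The field `lt_genus` is the convention that the genus is the integer part
of the exponent. -/
structure IsSpectralType (S : ℕ → ℂ) (θ c : ℝ) (E : ExpansionData) : Prop where
  ne_zero : ∀ n, S n ≠ 0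
  tendsto : Tendsto S cofinite (cobounded ℂ)
  finite_exponent : FiniteExponent S
  lt_genus : convExponent S - 1 < (genus S : ℝ)
  c_pos : 0 < c
  θ_pos : 0 < θ
  θ_lt_pi : θ < Real.pi
  mem_sector : ∀ n, S n ∈ interior (spectralSector θ c)
  expansion : HasLogGammaExpansion S θ c E

/-- Regular: no coefficient `a_{α,k}` with `k ≠ 0, 1`. -/
structure IsRegularSpectralType (S : ℕ → ℂ) (θ c : ℝ) (E : ExpansionData) : Prop
    extends IsSpectralType S θ c E where
  regular : ∀ j : ℕ, (j : ℕ∞) ≤ E.N → ∀ k : ℕ, k ≠ 0 → k ≠ 1 → (E.a j).coeff k = 0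

/-- Totally regular: regular, and the only logarithmic terms are `(-λ)^m log (-λ)` with integer
`m ≥ 0`. -/
structure IsTotallyRegular (S : ℕ → ℂ) (θ c : ℝ) (E : ExpansionData) : Prop
    extends IsRegularSpectralType S θ c E where
  totally : ∀ j : ℕ, (j : ℕ∞) ≤ E.N → (E.a j).coeff 1 ≠ 0 → ∃ m : ℕ, E.α j = (m : ℝ)

/-- The double sequence `S = {S n k}` is spectrally decomposable over `U = {u_n}` with power `κ`,
length `ℓ` and asymptotic domain `AD_{θ,c}`. `S n` is the simple sequence with `n` fixed. -/
def IsSpectrallyDecomposable (S : ℕ → ℕ → ℂ) (U : ℕ → ℂ) (κ : ℝ) (ℓ : ℕ) (θ c : ℝ) : Prop :=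
  0 < κ ∧
  ∃ (s₁ s₂ : ℝ) (p₁ p₂ : ℕ) (θ₀ c₀ φ d θ' c' : ℝ) (E : ExpansionData),
    -- `S` consists of non vanishing numbers accumulating only at infinity,
    (∀ n k, S n k ≠ 0) ∧
    Tendsto (fun q : ℕ × ℕ => S q.1 q.2) cofinite (cobounded ℂ) ∧
    -- it has finite exponent, finite relative exponents `s₁, s₂` and relative genera `p₁, p₂`,
    FiniteExponent (fun q : ℕ × ℕ => S q.1 q.2) ∧
    (∀ k, FiniteExponent (fun n => S n k) ∧ convExponent (fun n => S n k) = s₁ ∧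
      genus (fun n => S n k) = p₁) ∧
    (∀ n, FiniteExponent (S n) ∧ convExponent (S n) = s₂ ∧ genus (S n) = p₂) ∧
    -- and spectral sector `Σ_{θ₀,c₀}`,
    0 < c₀ ∧ 0 < θ₀ ∧ θ₀ < Real.pi ∧ (∀ n k, S n k ∈ interior (spectralSector θ₀ c₀)) ∧
    -- `U` is totally regular of order `≤ 0` with domain `AD_{φ,d}`,
    IsTotallyRegular U φ d E ∧ E.order ≤ 0 ∧
    -- the domain `AD_{θ,c}`,
    c = min c₀ (min d c') ∧ θ = max θ₀ (max φ θ') ∧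
    -- (1) every `u_n^{-κ} S_n` is totally regular of order `≤ 0` with spectral sector `Σ_{θ',c'}`,
    (∀ n, ∃ F : ExpansionData,
      IsTotallyRegular (fun k => U n ^ (-(κ : ℂ)) * S n k) θ' c' F ∧ F.order ≤ 0) ∧
    -- (2) the expansion of `log Γ(-λ, u_n^{-κ} S_n)` for large `n`, uniform in `λ ∈ AD_{θ,c}`
    -- relative to `(1 + |λ|)^{p₂}`.
    ∃ (L : ℕ) (σ : Fin (ℓ + 1) → ℝ) (ρ : Fin (L + 1) → ℝ)
      (Φ : Fin (ℓ + 1) → ℂ → ℂ) (P : Fin (L + 1) → Polynomial ℂ),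
      StrictMono σ ∧ StrictMono ρ ∧
      (∀ h, σ h ≤ convExponent U) ∧ (∀ l, ρ l ≤ convExponent U) ∧
      (∀ l, (P l).eval 0 = 0) ∧
      E.order < ((min (σ 0) (ρ 0 - 1) : ℝ) : EReal) ∧
      ∀ ε : ℝ, 0 < ε → ∀ᶠ n in atTop, ∀ lam ∈ asymptoticDomain θ c,
        ‖logGamma (fun k => U n ^ (-(κ : ℂ)) * S n k) lam
          - (∑ h, Φ h lam * U n ^ (-((σ h : ℝ) : ℂ))
            + ∑ l, (P l).eval lam * U n ^ (-((ρ l : ℝ) : ℂ)) * Complex.log (U n))‖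
          ≤ ε * ‖U n‖ ^ (-convExponent U) * (1 + ‖lam‖) ^ p₂

end

/-!
Write `x = λ_{(1),n}`, `μ_k = λ_{(2),k}`, let `p` be the genus of `{μ_k}`, `r₀` the exponent of
`{λ_{(1),n}}`, and `F(Λ) = log Γ(-Λ, {μ_k})`. The rescaled sequence is `w_k = 1 + μ_k / x`, and
`1 - λ / w_k` is the quotient of `1 - x (λ - 1) / μ_k` by `1 + x / μ_k`. Hence
`log Γ(-λ, {w_k}) = F(x (λ - 1)) - q(λ)` with a polynomial `q` of degree at most `p`
(`exists_logGamma_shift`; the logarithms split without a multiple of `2πi` because the domain is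
star-shaped, and `q` is a polynomial because it is a pointwise limit of polynomials of bounded
degree). Since the left-hand side vanishes to order `p + 1` at `λ = 0`, `q` is the Taylor polynomial
of `F(x (λ - 1))`.

Inserting the expansion of `F` at `-Λ = x (1 - λ)` has two consequences.

* For fixed `x` and `λ → ∞`, re-expanding `(1 - λ)^α` and `log (1 - λ)` in powers of `-λ` gives a
  totally regular expansion of `log Γ(-λ, {w_k})`, which is cut off at the power `0`
  (`IsTotallyRegular.shift`). Such finite expansions are handled as a class of functions closed
  under sums and multiples (`HasFiniteExpansion`).
* For `x → ∞`, the term with power `α_h` contributes `x^{α_h}` times `(1 - λ)^{α_h}` or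
  `(1 - λ)^{α_h} log (1 - λ)`, with the Taylor polynomial of degree `p` removed. The remainder of
  `F` is `o(|Λ|^{-r₀})` and `|x (λ - 1)| ≥ δ x` on `AD_{θ,c}` as `c < 1`, so the remainder is
  `o(x^{-r₀})` uniformly in `λ`; by Cauchy's estimate its Taylor polynomial is
  `o(x^{-r₀}) (1 + |λ|)^p` (`norm_eval_le_of_isBigO_sub`, `IsTotallyRegular.uniform_expansion`).

All powers are smaller than `p + 1`, because `F` grows more slowly than `|Λ|^{p+1}` along the negative
axis (`IsSpectralType.leading_power_lt`). This gives the required inequality between the order of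
`{λ_{(1),n}}` and the powers, and it removes the terms with `log x`: they multiply `(1 - λ)^m` with
an integer `m ≤ p`, which is its own Taylor polynomial.
-/

/-! ### Taylor polynomials at the origin -/

/-- The Taylor polynomial of degree at most `p` of `f` at the origin. -/
noncomputable def taylorPoly (p : ℕ) (f : ℂ → ℂ) : Polynomial ℂ :=
  ∑ j ∈ Finset.range (p + 1), Polynomial.monomial j (iteratedDeriv j f 0 / (j.factorial : ℂ))

lemma taylorPoly_coeff (p : ℕ) (f : ℂ → ℂ) {j : ℕ} (hj : j ≤ p) :
    (taylorPoly p f).coeff j = iteratedDeriv j f 0 / (j.factorial : ℂ) := by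
  simp only [taylorPoly, Polynomial.finsetSum_coeff, Polynomial.coeff_monomial]
  rw [Finset.sum_ite_eq' (Finset.range (p + 1)) j]
  simp [Nat.lt_succ_of_le hj]

lemma natDegree_taylorPoly_le (p : ℕ) (f : ℂ → ℂ) : (taylorPoly p f).natDegree ≤ p := by
  refine Polynomial.natDegree_sum_le_of_forall_le _ _ fun j hj => ?_
  exact (Polynomial.natDegree_monomial_le _).trans (Nat.lt_succ_iff.1 (Finset.mem_range.1 hj))

lemma isBigO_sub_taylorPoly {f : ℂ → ℂ} (hf : AnalyticAt ℂ f 0) (p : ℕ) :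
    (fun z => f z - (taylorPoly p f).eval z) =O[𝓝 0] (fun z : ℂ => z ^ (p + 1)) := by
  obtain ⟨G, hG, hfG⟩ := hf.exists_eventuallyEq_sum_add_pow_mul (p + 1)
  have h1 : (fun z => f z - (taylorPoly p f).eval z) =ᶠ[𝓝 0] fun z => z ^ (p + 1) * G z := by
    filter_upwards [hfG] with z hz
    rw [hz, taylorPoly, Polynomial.eval_finsetSum, smul_eq_mul]
    simp only [Polynomial.eval_monomial, smul_eq_mul]
    rw [add_sub_right_comm, ← Finset.sum_sub_distrib]
    rw [Finset.sum_eq_zero fun j _ => by ring, zero_add]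
  refine h1.trans_isBigO ?_
  simpa using (isBigO_refl (fun z : ℂ => z ^ (p + 1)) (𝓝 0)).mul (hG.continuousAt.isBigO_one ℂ)

/-- A polynomial of degree at most `p` that vanishes to order `p + 1` at the origin is zero. -/
lemma polynomial_eq_zero_of_isBigO {p : ℕ} {P : Polynomial ℂ} (hP : P.natDegree ≤ p)
    (h : (fun z => P.eval z) =O[𝓝 0] (fun z : ℂ => z ^ (p + 1))) : P = 0 := by
  induction p generalizing P with
  | zero =>
    obtain ⟨c, rfl⟩ := Polynomial.natDegree_eq_zero.1 (Nat.le_zero.1 hP)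
    simp only [Polynomial.eval_C] at h
    have h1 : Tendsto (fun _ : ℂ => c) (𝓝 0) (𝓝 0) := h.trans_tendsto (by
      simpa using (continuous_pow (M := ℂ) (0 + 1)).tendsto 0)
    rw [tendsto_nhds_unique h1 tendsto_const_nhds |>.symm, Polynomial.C_0]
  | succ p ih =>
    have h0 : P.eval 0 = 0 := by
      have h1 : Tendsto (fun z : ℂ => P.eval z) (𝓝 0) (𝓝 0) := h.trans_tendsto (by
        simpa using (continuous_pow (M := ℂ) (p + 1 + 1)).tendsto 0)
      exact tendsto_nhds_unique (P.continuous.tendsto 0) h1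
    have hd : P.divX * Polynomial.X = P := by
      have := Polynomial.divX_mul_X_add P
      rwa [Polynomial.coeff_zero_eq_eval_zero, h0, Polynomial.C_0, add_zero] at this
    have h2 : (fun z => P.divX.eval z) =O[𝓝[≠] 0] (fun z : ℂ => z ^ (p + 1)) := by
      obtain ⟨C, hC⟩ := (h.mono (nhdsWithin_le_nhds (s := {0}ᶜ))).bound
      refine IsBigO.of_bound C ?_
      filter_upwards [hC, self_mem_nhdsWithin] with z hz hz0
      have hz0 : 0 < ‖z‖ := norm_pos_iff.2 hz0
      rw [← hd, Polynomial.eval_mul, Polynomial.eval_X, norm_mul, pow_succ z, norm_mul,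
        ← mul_assoc] at hz
      exact le_of_mul_le_mul_right hz hz0
    have h3 : (fun z => P.divX.eval z) =O[𝓝 0] (fun z : ℂ => z ^ (p + 1)) := by
      have h4 : Tendsto (fun z => P.divX.eval z) (𝓝[≠] 0) (𝓝 0) := h2.trans_tendsto (by
        simpa using ((continuous_pow (M := ℂ) (p + 1)).tendsto 0).mono_left nhdsWithin_le_nhds)
      have h5 : P.divX.eval 0 = 0 :=
        tendsto_nhds_unique ((P.divX.continuous.tendsto 0).mono_left nhdsWithin_le_nhds) h4
      rw [← nhdsNE_sup_pure (0 : ℂ)]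
      exact h2.sup (isBigO_pure.2 fun _ => h5)
    have h6 := ih (P := P.divX) (by rw [Polynomial.natDegree_divX_eq_natDegree_tsub_one]; omega) h3
    rw [← hd, h6, zero_mul]

/-- Cauchy's estimate for the Taylor polynomial: if `q` has degree at most `p` and `f - q` vanishes
to order `p + 1` at the origin, then `q` is bounded by the supremum of `|f|` on a circle. -/
lemma norm_eval_le_of_isBigO_sub {f : ℂ → ℂ} {q : Polynomial ℂ} {p : ℕ} {R η M : ℝ} (hη : 0 < η)
    (hηR : η < R) (hf : DifferentiableOn ℂ f (Metric.ball 0 R)) (hq : q.natDegree ≤ p)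
    (hfq : (fun z => f z - q.eval z) =O[𝓝 0] (fun z : ℂ => z ^ (p + 1)))
    (hM : ∀ z, ‖z‖ = η → ‖f z‖ ≤ M) (z : ℂ) :
    ‖q.eval z‖ ≤ (∑ j ∈ Finset.range (p + 1), (η ^ j)⁻¹) * M * (1 + ‖z‖) ^ p := by
  have hfa : AnalyticAt ℂ f 0 :=
    hf.analyticAt (Metric.ball_mem_nhds 0 (hη.trans hηR))
  have hqt : q = taylorPoly p f := by
    rw [← sub_eq_zero]
    refine polynomial_eq_zero_of_isBigO
      ((Polynomial.natDegree_sub_le _ _).trans (max_le hq (natDegree_taylorPoly_le p f))) ?_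
    refine ((isBigO_sub_taylorPoly hfa p).sub hfq).congr_left fun z => ?_
    rw [Polynomial.eval_sub]; ring
  have hcoeff : ∀ j ≤ p, ‖q.coeff j‖ ≤ (η ^ j)⁻¹ * M := by
    intro j hj
    have hd : DiffContOnCl ℂ f (Metric.ball 0 η) :=
      DifferentiableOn.diffContOnCl <| hf.mono <|
        Metric.closure_ball_subset_closedBall.trans (Metric.closedBall_subset_ball hηR)
    have := Complex.norm_iteratedDeriv_le_of_forall_mem_sphere_norm_le j hη hd
      (C := M) (fun z hz => hM z (by simpa using hz))
    rw [hqt, taylorPoly_coeff p f hj, norm_div, Complex.norm_natCast,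
      div_le_iff₀ (by positivity)]
    calc _ ≤ _ := this
      _ = _ := by ring
  rw [Polynomial.eval_eq_sum_range' (Nat.lt_succ_of_le hq), mul_assoc, Finset.sum_mul]
  refine (norm_sum_le _ _).trans (Finset.sum_le_sum fun j hj => ?_)
  have hj : j ≤ p := Nat.lt_succ_iff.1 (Finset.mem_range.1 hj)
  rw [norm_mul, norm_pow, ← mul_assoc]
  have h1 : ‖z‖ ^ j ≤ (1 + ‖z‖) ^ p :=
    (pow_le_pow_left₀ (norm_nonneg z) (by linarith) j).trans
      (pow_le_pow_right₀ (by linarith [norm_nonneg z]) hj)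
  exact mul_le_mul (hcoeff j hj) h1 (by positivity) ((norm_nonneg _).trans (hcoeff j hj))

/-! ### Sectors -/

lemma tan_half_pos {θ : ℝ} (h0 : 0 < θ) (hπ : θ < Real.pi) : 0 < Real.tan (θ / 2) :=
  Real.tan_pos_of_pos_of_lt_pi_div_two (by linarith) (by linarith)

/-- Cartesian description of the sector: it is a convex cone with apex `c`. -/
lemma mem_spectralSector_iff {θ c : ℝ} (h0 : 0 < θ) (hπ : θ < Real.pi) {z : ℂ} :
    z ∈ spectralSector θ c ↔ |z.im| ≤ Real.tan (θ / 2) * (z.re - c) := by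
  have ht := tan_half_pos h0 hπ
  set w : ℂ := z - c with hw
  have him : z.im = w.im := by simp [hw]
  have hre : z.re - c = w.re := by simp [hw]
  rw [him, hre]
  change |Complex.arg w| ≤ θ / 2 ↔ _
  have hmem : θ / 2 ∈ Set.Ioo (-(Real.pi / 2)) (Real.pi / 2) := ⟨by linarith, by linarith⟩
  have hmem' : -(θ / 2) ∈ Set.Ioo (-(Real.pi / 2)) (Real.pi / 2) := ⟨by linarith, by linarith⟩
  -- for a point of the open right half plane both conditions compare `tan (arg w)` with `tan (θ/2)`
  have key : 0 < w.re → (|Complex.arg w| ≤ θ / 2 ↔ |w.im| ≤ Real.tan (θ / 2) * w.re) := by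
    intro hpos
    have ha := abs_lt.1 (Complex.abs_arg_lt_pi_div_two_iff.2 (Or.inl hpos))
    have hmemw : Complex.arg w ∈ Set.Ioo (-(Real.pi / 2)) (Real.pi / 2) := ha
    rw [abs_le, abs_le, ← Real.strictMonoOn_tan.le_iff_le hmem' hmemw,
      ← Real.strictMonoOn_tan.le_iff_le hmemw hmem, Complex.tan_arg, Real.tan_neg,
      le_div_iff₀ hpos, div_le_iff₀ hpos, neg_mul]
  constructor
  · intro h
    rcases Complex.abs_arg_lt_pi_div_two_iff.1 (show |w.arg| < Real.pi / 2 by linarith) with h1 | h1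
    · exact (key h1).1 h
    · simp [h1]
  · intro h
    have h1 : 0 ≤ w.re := by
      by_contra hneg
      nlinarith [abs_nonneg w.im, mul_pos ht (neg_pos.2 (not_le.1 hneg))]
    rcases h1.eq_or_lt with h2 | h2
    · rw [← h2, mul_zero] at h
      have h3 : w = 0 := Complex.ext h2.symm (abs_nonpos_iff.1 h)
      simp [h3]; linarith
    · exact (key h2).2 h

lemma mem_interior_spectralSector_iff {θ c : ℝ} (h0 : 0 < θ) (hπ : θ < Real.pi) {z : ℂ} :
    z ∈ interior (spectralSector θ c) ↔ |z.im| < Real.tan (θ / 2) * (z.re - c) := by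
  have ht := tan_half_pos h0 hπ
  constructor
  · intro h
    obtain ⟨ε, hε, hb⟩ := Metric.mem_nhds_iff.1 (mem_interior_iff_mem_nhds.1 h)
    have hm : z - ((ε / 2 : ℝ) : ℂ) ∈ Metric.ball z ε := by
      rw [Metric.mem_ball, dist_eq_norm, sub_sub_cancel_left, norm_neg, Complex.norm_real,
        Real.norm_eq_abs, abs_of_pos (half_pos hε)]
      linarith
    have := (mem_spectralSector_iff h0 hπ).1 (hb hm)
    rw [Complex.sub_im, Complex.ofReal_im, sub_zero, Complex.sub_re, Complex.ofReal_re] at this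
    nlinarith [mul_pos ht hε]
  · intro h
    have ho : IsOpen {z : ℂ | |z.im| < Real.tan (θ / 2) * (z.re - c)} :=
      isOpen_lt (by fun_prop) (by fun_prop)
    exact interior_maximal (fun w hw => (mem_spectralSector_iff h0 hπ).2 (le_of_lt hw)) ho h

lemma mem_asymptoticDomain_iff {θ c : ℝ} (h0 : 0 < θ) (hπ : θ < Real.pi) {z : ℂ} :
    z ∈ asymptoticDomain θ c ↔ Real.tan (θ / 2) * (z.re - c) < |z.im| := by
  rw [asymptoticDomain, Set.mem_compl_iff, mem_spectralSector_iff h0 hπ, not_le]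

lemma tan_half_mono {θ θ' : ℝ} (h0 : 0 < θ) (h : θ ≤ θ') (hπ : θ' < Real.pi) :
    Real.tan (θ / 2) ≤ Real.tan (θ' / 2) :=
  Real.strictMonoOn_tan.monotoneOn (a := θ / 2) (b := θ' / 2) ⟨by linarith, by linarith⟩
    ⟨by linarith, by linarith⟩ (by linarith)

/-- Points of the interior of the sector lie strictly to the right of its apex. -/
lemma lt_re_of_mem_interior {θ c : ℝ} (h0 : 0 < θ) (hπ : θ < Real.pi) {z : ℂ}
    (hz : z ∈ interior (spectralSector θ c)) : c < z.re := by
  have h := (mem_interior_spectralSector_iff h0 hπ).1 hz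
  have := (mul_pos_iff_of_pos_left (tan_half_pos h0 hπ)).1 ((abs_nonneg _).trans_lt h)
  linarith

lemma ball_subset_asymptoticDomain {θ c : ℝ} (h0 : 0 < θ) (hπ : θ < Real.pi) :
    Metric.ball (0 : ℂ) c ⊆ asymptoticDomain θ c := by
  intro z hz
  rw [mem_asymptoticDomain_iff h0 hπ]
  have h1 : z.re < c :=
    ((le_abs_self _).trans (Complex.abs_re_le_norm z)).trans_lt (by simpa using hz)
  have := mul_pos (tan_half_pos h0 hπ) (sub_pos.2 h1)
  nlinarith [abs_nonneg z.im]

/-- The domain is star-shaped about the origin. -/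
lemma smul_mem_asymptoticDomain {θ c : ℝ} (h0 : 0 < θ) (hπ : θ < Real.pi) (hc : 0 < c) {z : ℂ}
    (hz : z ∈ asymptoticDomain θ c) {t : ℝ} (ht0 : 0 ≤ t) (ht1 : t ≤ 1) :
    (t : ℂ) * z ∈ asymptoticDomain θ c := by
  rw [mem_asymptoticDomain_iff h0 hπ] at hz ⊢
  have ht := tan_half_pos h0 hπ
  rw [Complex.re_ofReal_mul, Complex.im_ofReal_mul, abs_mul, abs_of_nonneg ht0]
  rcases ht0.eq_or_lt with rfl | hpos
  · simp; positivity
  · nlinarith [mul_lt_mul_of_pos_left hz hpos, mul_nonneg (mul_pos ht hc).le (sub_nonneg.2 ht1)]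

/-- For `s` in the sector and `z` in its complement, `1 - z / s` avoids the cut of the logarithm. -/
lemma one_add_neg_div_mem_slitPlane {θ c : ℝ} (h0 : 0 < θ) (hπ : θ < Real.pi) (hc : 0 < c)
    {z s : ℂ} (hz : z ∈ asymptoticDomain θ c) (hs : s ∈ spectralSector θ c) :
    1 + (-z) / s ∈ Complex.slitPlane := by
  have ht := tan_half_pos h0 hπ
  rw [mem_spectralSector_iff h0 hπ] at hs
  have hsre : 0 < s.re := by
    have := (mul_nonneg_iff_of_pos_left ht).1 ((abs_nonneg _).trans hs)
    linarith
  have hs0 : s ≠ 0 := by rintro rfl; simp at hsre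
  rw [Complex.mem_slitPlane_iff_not_le_zero]
  intro hle
  obtain ⟨hre, him⟩ := Complex.le_def.1 hle
  set v : ℂ := 1 + (-z) / s with hv
  have hvr : v = ((v.re : ℝ) : ℂ) := Complex.ext (by simp) (by simpa using him)
  have hzv : z = ((1 - v.re : ℝ) : ℂ) * s := by
    rw [Complex.ofReal_sub, ← hvr, hv]; push_cast; field_simp; ring
  simp only [Complex.zero_re] at hre
  rw [mem_asymptoticDomain_iff h0 hπ, hzv, Complex.re_ofReal_mul, Complex.im_ofReal_mul, abs_mul,
    abs_of_pos (by linarith : 0 < 1 - v.re)] at hz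
  nlinarith [mul_le_mul_of_nonneg_left hs (by linarith : 0 ≤ 1 - v.re),
    mul_nonneg (mul_pos ht hc).le (neg_nonneg.2 hre)]

/-- The affine map `λ ↦ x (λ - 1)` carries `AD_{θ',c'}` with `c' ≤ 1` into `AD_{θ,c}` whenever
`θ ≤ θ'` and `0 < c`. -/
lemma mul_sub_one_mem_asymptoticDomain {θ θ' c c' x : ℝ} (h0 : 0 < θ) (hθ : θ ≤ θ')
    (hπ : θ' < Real.pi) (hc : 0 < c) (hc' : c' ≤ 1) (hx : 0 < x) {z : ℂ}
    (hz : z ∈ asymptoticDomain θ' c') : (x : ℂ) * (z - 1) ∈ asymptoticDomain θ c := by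
  have ht := tan_half_pos h0 (hθ.trans_lt hπ)
  have htt := tan_half_mono h0 hθ hπ
  rw [mem_asymptoticDomain_iff (h0.trans_le hθ) hπ] at hz
  rw [mem_asymptoticDomain_iff h0 (hθ.trans_lt hπ), Complex.re_ofReal_mul, Complex.im_ofReal_mul,
    abs_mul, abs_of_pos hx, Complex.sub_re, Complex.sub_im, Complex.one_re, Complex.one_im, sub_zero]
  rcases le_or_gt (z.re - 1) 0 with h1 | h1
  · have := mul_nonneg hx.le (abs_nonneg z.im)
    nlinarith [mul_pos ht hc, mul_nonneg ht.le (mul_nonneg hx.le (neg_nonneg.2 h1))]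
  · have h2 : Real.tan (θ / 2) * (z.re - 1) < |z.im| := by
      refine lt_of_le_of_lt ?_ hz
      exact mul_le_mul htt (by linarith) h1.le (ht.le.trans htt)
    nlinarith [mul_lt_mul_of_pos_left h2 hx, mul_pos ht hc]

/-- If `c < 1`, the point `1` keeps a positive distance from `AD_{θ,c}`. -/
lemma exists_le_norm_sub_one {θ c : ℝ} (h0 : 0 < θ) (hπ : θ < Real.pi) (hc : c < 1) :
    ∃ δ : ℝ, 0 < δ ∧ ∀ z ∈ asymptoticDomain θ c, δ ≤ ‖z - 1‖ := by
  have h1 : (1 : ℂ) ∈ interior (spectralSector θ c) := by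
    rw [mem_interior_spectralSector_iff h0 hπ]
    simpa using mul_pos (tan_half_pos h0 hπ) (sub_pos.2 hc)
  obtain ⟨δ, hδ, hb⟩ := Metric.mem_nhds_iff.1 (mem_interior_iff_mem_nhds.1 h1)
  refine ⟨δ, hδ, fun z hz => ?_⟩
  by_contra hlt
  exact hz (hb (by rw [Metric.mem_ball, dist_eq_norm]; exact not_le.1 hlt))

lemma one_sub_mem_slitPlane {θ c : ℝ} (h0 : 0 < θ) (hπ : θ < Real.pi) (hc : c ≤ 1) {z : ℂ}
    (hz : z ∈ asymptoticDomain θ c) : 1 - z ∈ Complex.slitPlane := by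
  rw [mem_asymptoticDomain_iff h0 hπ] at hz
  rw [Complex.mem_slitPlane_iff_not_le_zero]
  intro hle
  obtain ⟨hre, him⟩ := Complex.le_def.1 hle
  simp only [Complex.sub_re, Complex.one_re, Complex.sub_im, Complex.one_im, Complex.zero_re,
    Complex.zero_im, zero_sub, neg_eq_zero] at hre him
  rw [him, abs_zero] at hz
  nlinarith [tan_half_pos h0 hπ]

/-! ### The terms of the series for `log Γ` -/

/-- The logarithm of a Weierstrass factor of genus `p`, as it enters `logGamma`. -/
noncomputable def logTerm (p : ℕ) (w : ℂ) : ℂ :=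
  Complex.log (1 + w) + ∑ j ∈ Finset.Icc 1 p, ((-1 : ℂ) ^ j / (j : ℂ)) * w ^ j

lemma logGamma_eq {ι : Type*} (S : ι → ℂ) (z : ℂ) :
    logGamma S z = -∑' i, logTerm (genus S) (-z / S i) := rfl

lemma logTerm_eq_sub (p : ℕ) (w : ℂ) :
    logTerm p w = Complex.log (1 + w) - Complex.logTaylor (p + 1) w := by
  rw [logTerm, Complex.logTaylor, sub_eq_add_neg, ← Finset.sum_neg_distrib]
  congr 1
  rw [Finset.range_eq_Ico, Finset.sum_eq_sum_Ico_succ_bot (Nat.succ_pos p)]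
  simp only [Nat.cast_zero, div_zero, neg_zero, zero_add]
  refine Finset.sum_congr (by ext; simp) fun j _ => ?_
  rw [pow_succ]; ring

lemma norm_logTerm_le (p : ℕ) {w : ℂ} (hw : ‖w‖ ≤ 1 / 2) :
    ‖logTerm p w‖ ≤ 2 * ‖w‖ ^ (p + 1) := by
  rw [logTerm_eq_sub]
  refine (Complex.norm_log_sub_logTaylor_le p (by linarith)).trans ?_
  have h1 : (1 - ‖w‖)⁻¹ ≤ 2 := by
    rw [inv_le_comm₀ (by linarith) two_pos]; norm_num; linarith
  have h2 : (1 : ℝ) ≤ p + 1 := by simp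
  refine (div_le_self (by have : 0 < 1 - ‖w‖ := by linarith
                          positivity) h2).trans ?_
  rw [mul_comm]
  gcongr

lemma norm_log_le_abs_log_norm_add_pi (z : ℂ) : ‖Complex.log z‖ ≤ |Real.log ‖z‖| + Real.pi := by
  refine (Complex.norm_le_abs_re_add_abs_im _).trans ?_
  rw [Complex.log_re, Complex.log_im]
  gcongr
  exact Complex.abs_arg_le_pi z

lemma norm_neg_one_pow_div_le_one (j : ℕ) : ‖(-1 : ℂ) ^ j / (j : ℂ)‖ ≤ 1 := by
  rw [norm_div, norm_pow, norm_neg, norm_one, one_pow, Complex.norm_natCast]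
  rcases j.eq_zero_or_pos with rfl | hj
  · simp
  · exact div_le_one_of_le₀ (by exact_mod_cast hj) (by positivity)

/-- A bound for the Weierstrass factors on a half plane, used as a dominating function. -/
lemma exists_norm_logTerm_le_of_re_nonneg (p : ℕ) :
    ∃ C : ℝ, ∀ w : ℂ, 0 ≤ w.re → ‖logTerm p w‖ ≤ C * ‖w‖ ^ (p + 1) := by
  refine ⟨2 + (1 + 2 * Real.pi + p) * 2 ^ (p + 1), fun w hw => ?_⟩
  have hpi := Real.pi_pos
  rcases le_total ‖w‖ (1 / 2) with h | h
  · refine (norm_logTerm_le p h).trans ?_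
    gcongr
    simp only [le_add_iff_nonneg_right]; positivity
  · have hpow : ∀ j ≤ p + 1, ‖w‖ ^ j ≤ 2 ^ (p + 1) * ‖w‖ ^ (p + 1) := by
      intro j hj
      rw [← mul_pow]
      exact (pow_le_pow_left₀ (norm_nonneg w) (by linarith [norm_nonneg w]) j).trans
        (pow_le_pow_right₀ (by linarith) hj)
    have h1 : (1 : ℝ) ≤ ‖1 + w‖ := by
      refine le_trans ?_ ((le_abs_self _).trans (Complex.abs_re_le_norm _))
      simpa using hw
    have hlog : ‖Complex.log (1 + w)‖ ≤ (1 + 2 * Real.pi) * ‖w‖ := by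
      refine (norm_log_le_abs_log_norm_add_pi _).trans ?_
      rw [abs_of_nonneg (Real.log_nonneg h1)]
      have h2 := Real.log_le_sub_one_of_pos (by linarith : 0 < ‖1 + w‖)
      have h3 : ‖1 + w‖ ≤ 1 + ‖w‖ := by simpa using norm_add_le 1 w
      nlinarith
    have hsum : ‖∑ j ∈ Finset.Icc 1 p, ((-1 : ℂ) ^ j / (j : ℂ)) * w ^ j‖
        ≤ p * (2 ^ (p + 1) * ‖w‖ ^ (p + 1)) := by
      refine (norm_sum_le_of_le (n := fun _ => 2 ^ (p + 1) * ‖w‖ ^ (p + 1)) _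
        (fun j hj => ?_)).trans_eq ?_
      · rw [norm_mul, norm_pow]
        have := hpow j (by have := (Finset.mem_Icc.1 hj).2; omega)
        calc _ ≤ 1 * ‖w‖ ^ j := by gcongr; exact norm_neg_one_pow_div_le_one j
          _ ≤ _ := by rwa [one_mul]
      · simp
    have hw1 := hpow 1 (by omega)
    rw [pow_one] at hw1
    refine (norm_add_le _ _).trans ((add_le_add hlog hsum).trans ?_)
    have h4 : (1 + 2 * Real.pi) * ‖w‖ ≤ (1 + 2 * Real.pi) * (2 ^ (p + 1) * ‖w‖ ^ (p + 1)) := by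
      gcongr
    have h5 : 0 ≤ ‖w‖ ^ (p + 1) := by positivity
    nlinarith

lemma logTerm_isLittleO (p : ℕ) :
    logTerm p =o[cobounded ℂ] (fun w : ℂ => ‖w‖ ^ (p + 1)) := by
  have hnorm : Tendsto (fun w : ℂ => ‖w‖) (cobounded ℂ) atTop := tendsto_norm_cobounded_atTop
  have hpow : ∀ j ≤ p, (fun w : ℂ => ‖w‖ ^ j) =o[cobounded ℂ] (fun w : ℂ => ‖w‖ ^ (p + 1)) :=
    fun j hj => (isLittleO_pow_pow_atTop_of_lt (Nat.lt_succ_of_le hj)).comp_tendsto hnorm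
  have h1w : Tendsto (fun w : ℂ => ‖1 + w‖) (cobounded ℂ) atTop := by
    refine tendsto_atTop_mono (fun w => ?_) (tendsto_atTop_add_const_right _ (-1) hnorm)
    have := norm_sub_norm_le w (-1)
    rw [norm_neg, norm_one, sub_neg_eq_add, add_comm w] at this
    linarith
  have hself : (fun w : ℂ => ‖w‖) =O[cobounded ℂ] (fun w : ℂ => ‖w‖ ^ (p + 1)) := by
    refine IsBigO.of_bound 1 ?_
    filter_upwards [hnorm.eventually_ge_atTop 1] with w hw
    rw [Real.norm_of_nonneg (norm_nonneg w), Real.norm_of_nonneg (by positivity), one_mul]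
    exact le_self_pow₀ hw (Nat.succ_ne_zero p)
  have hlog : (fun w : ℂ => Complex.log (1 + w)) =o[cobounded ℂ]
      (fun w : ℂ => ‖w‖ ^ (p + 1)) := by
    have h2 : (fun w : ℂ => Real.log ‖1 + w‖) =o[cobounded ℂ] (fun w : ℂ => ‖w‖) := by
      refine (Real.isLittleO_log_id_atTop.comp_tendsto h1w).trans_isBigO ?_
      refine IsBigO.of_bound 2 ?_
      filter_upwards [hnorm.eventually_ge_atTop 1] with w hw
      have h3 : ‖1 + w‖ ≤ 1 + ‖w‖ := by simpa using norm_add_le 1 w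
      simp only [Function.comp, id, norm_norm]
      linarith
    have h3 : (fun _ : ℂ => Real.pi) =o[cobounded ℂ] (fun w : ℂ => ‖w‖ ^ (p + 1)) := by
      refine (isBigO_const_const Real.pi (one_ne_zero (α := ℝ)) _).trans_isLittleO ?_
      simpa using hpow 0 (Nat.zero_le p)
    refine IsBigO.trans_isLittleO (IsBigO.of_norm_le fun w => ?_)
      ((h2.trans_isBigO hself).norm_left.add h3)
    exact norm_log_le_abs_log_norm_add_pi (1 + w)
  refine hlog.add (IsLittleO.fun_sum fun j hj => ?_)
  refine IsBigO.trans_isLittleO ?_ (hpow j (Finset.mem_Icc.1 hj).2)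
  refine IsBigO.of_norm_le fun w => ?_
  rw [norm_mul, norm_pow]
  exact mul_le_of_le_one_left (by positivity) (norm_neg_one_pow_div_le_one j)

/-! ### Convergence -/

lemma eventually_le_norm {ι : Type*} {S : ι → ℂ} (ht : Tendsto S cofinite (cobounded ℂ))
    (R : ℝ) : ∀ᶠ i in cofinite, R ≤ ‖S i‖ :=
  (tendsto_norm_cobounded_atTop.comp ht).eventually_ge_atTop R

/-- The infimum in the definition of the genus is attained. -/
lemma summable_genus {ι : Type*} {S : ι → ℂ} (ht : Tendsto S cofinite (cobounded ℂ))
    (hS : FiniteExponent S) : Summable fun i => (‖S i‖ ^ (genus S + 1))⁻¹ := by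
  refine Nat.sInf_mem (s := {p : ℕ | Summable fun i => (‖S i‖ ^ (p + 1))⁻¹}) ?_
  obtain ⟨r, hr, hs⟩ := hS
  refine ⟨⌈r⌉₊, ?_⟩
  refine Summable.of_norm_bounded_eventually hs ?_
  filter_upwards [eventually_le_norm ht 1] with i hi
  rw [norm_inv, norm_pow, norm_norm, ← Real.rpow_natCast, ← Real.rpow_neg (norm_nonneg _)]
  refine Real.rpow_le_rpow_of_exponent_le hi (neg_le_neg ?_)
  push_cast
  linarith [Nat.le_ceil r]

lemma summable_logTerm {ι : Type*} {S : ι → ℂ} (ht : Tendsto S cofinite (cobounded ℂ))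
    (hS : FiniteExponent S) (z : ℂ) : Summable fun i => logTerm (genus S) (z / S i) := by
  refine Summable.of_norm_bounded_eventually
    ((summable_genus ht hS).mul_left (2 * ‖z‖ ^ (genus S + 1))) ?_
  filter_upwards [eventually_le_norm ht (2 * ‖z‖ + 1)] with i hi
  have h0 : 0 < ‖S i‖ := by linarith [norm_nonneg z]
  have h1 : ‖z / S i‖ ≤ 1 / 2 := by
    rw [norm_div, div_le_iff₀ h0]; linarith
  refine (norm_logTerm_le _ h1).trans_eq ?_
  rw [norm_div, div_pow, div_eq_mul_inv, mul_assoc]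

/-- Near the origin `log Γ(-λ, S)` is analytic and vanishes to order `genus S + 1`. -/
lemma logGamma_near_zero {ι : Type*} {S : ι → ℂ} (ht : Tendsto S cofinite (cobounded ℂ))
    (hS : FiniteExponent S) (h1 : ∀ i, 1 ≤ ‖S i‖) :
    DifferentiableOn ℂ (logGamma S) (Metric.ball 0 (1 / 2)) ∧
      logGamma S =O[𝓝 0] (fun z : ℂ => z ^ (genus S + 1)) := by
  have hsum := summable_genus ht hS
  have hle : ∀ z : ℂ, ‖z‖ ≤ 1 / 2 → ∀ i, ‖-z / S i‖ ≤ 1 / 2 := fun z hz i => by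
    rw [norm_div, norm_neg]
    exact (div_le_self (norm_nonneg z) (h1 i)).trans hz
  have hbd : ∀ z : ℂ, ‖z‖ ≤ 1 / 2 → ∀ i, ‖logTerm (genus S) (-z / S i)‖
      ≤ 2 * ‖z‖ ^ (genus S + 1) * (‖S i‖ ^ (genus S + 1))⁻¹ := fun z hz i => by
    refine (norm_logTerm_le _ (hle z hz i)).trans_eq ?_
    rw [norm_div, norm_neg, div_pow, div_eq_mul_inv, mul_assoc]
  constructor
  · refine DifferentiableOn.neg ?_
    refine Complex.differentiableOn_tsum_of_summable_norm (hsum.mul_left 2) (fun i z hz => ?_)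
      Metric.isOpen_ball (fun i z hz => ?_)
    · have hz : ‖z‖ ≤ 1 / 2 := (by simpa using hz : ‖z‖ < 1 / 2).le
      have hsl : 1 + -z / S i ∈ Complex.slitPlane :=
        Complex.mem_slitPlane_of_norm_lt_one ((hle z hz i).trans_lt (by norm_num))
      refine DifferentiableAt.differentiableWithinAt ?_
      refine DifferentiableAt.add (DifferentiableAt.clog (by fun_prop) hsl) (by fun_prop)
    · have hz : ‖z‖ ≤ 1 / 2 := (by simpa using hz : ‖z‖ < 1 / 2).le
      refine (hbd z hz i).trans ?_
      have : ‖z‖ ^ (genus S + 1) ≤ 1 := pow_le_one₀ (norm_nonneg z) (by linarith)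
      have : 0 ≤ (‖S i‖ ^ (genus S + 1))⁻¹ := by positivity
      nlinarith
  · refine IsBigO.of_bound (2 * ∑' i, (‖S i‖ ^ (genus S + 1))⁻¹) ?_
    filter_upwards [Metric.closedBall_mem_nhds (0 : ℂ) (by norm_num : (0 : ℝ) < 1 / 2)] with z hz
    have hz : ‖z‖ ≤ 1 / 2 := by simpa using hz
    rw [logGamma_eq, norm_neg, norm_pow]
    refine (tsum_of_norm_bounded ((hsum.mul_left (2 * ‖z‖ ^ (genus S + 1))).hasSum)
      (hbd z hz)).trans_eq ?_
    rw [tsum_mul_left]; ring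

/-! ### Growth along the negative axis -/

/-- Along the negative axis `log Γ(-λ, S)` is of smaller order than `|λ|^{p+1}`, `p` the genus. -/
lemma logGamma_neg_isLittleO {ι : Type*} {S : ι → ℂ} (ht : Tendsto S cofinite (cobounded ℂ))
    (hS : FiniteExponent S) (hre : ∀ i, 0 < (S i).re) :
    (fun t : ℝ => logGamma S (-(t : ℂ))) =o[atTop] (fun t : ℝ => (t : ℂ) ^ (genus S + 1)) := by
  obtain ⟨C, hC⟩ := exists_norm_logTerm_le_of_re_nonneg (genus S)
  have hS0 : ∀ i, S i ≠ 0 := fun i h => by have := hre i; simp [h] at this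
  rw [isLittleO_iff_tendsto' (by
    filter_upwards [eventually_gt_atTop 0] with t ht h
    exact absurd (eq_zero_of_pow_eq_zero h) (by exact_mod_cast ht.ne'))]
  have hmain : Tendsto (fun t : ℝ => ∑' i, logTerm (genus S) ((t : ℂ) / S i) /
      (t : ℂ) ^ (genus S + 1)) atTop (𝓝 (∑' _ : ι, 0)) := by
    refine tendsto_tsum_of_dominated_convergence ((summable_genus ht hS).mul_left C) (fun i => ?_) ?_
    · have hdiv : Tendsto (fun t : ℝ => (t : ℂ) / S i) atTop (cobounded ℂ) := by
        refine tendsto_norm_atTop_iff_cobounded.1 ?_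
        simp only [norm_div]
        refine Tendsto.atTop_div_const (norm_pos_iff.2 (hS0 i)) ?_
        simpa using tendsto_abs_atTop_atTop
      rw [← isLittleO_iff_tendsto' (by
        filter_upwards [eventually_gt_atTop 0] with t ht h
        exact absurd (eq_zero_of_pow_eq_zero h) (by exact_mod_cast ht.ne'))]
      refine ((logTerm_isLittleO (genus S)).comp_tendsto hdiv).trans_isBigO ?_
      refine IsBigO.of_bound ((‖S i‖ ^ (genus S + 1))⁻¹) (Eventually.of_forall fun t => le_of_eq ?_)
      simp only [Function.comp, norm_div, norm_pow, norm_norm]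
      rw [div_pow, div_eq_inv_mul]
    · filter_upwards [eventually_gt_atTop 0] with t ht i
      have hre' : 0 ≤ ((t : ℂ) / S i).re := by
        rw [Complex.div_re]
        simp only [Complex.ofReal_re, Complex.ofReal_im, zero_mul, zero_div, add_zero]
        have := (hre i).le
        have := Complex.normSq_nonneg (S i)
        positivity
      have ht' : 0 < ‖(t : ℂ)‖ := by simpa using ht.ne'
      rw [norm_div, norm_pow, div_le_iff₀ (by positivity)]
      refine (hC _ hre').trans_eq ?_
      rw [norm_div, div_pow]; ring
  rw [tsum_zero] at hmain
  have := hmain.neg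
  rw [neg_zero] at this
  refine this.congr fun t => ?_
  rw [logGamma_eq, tsum_div_const, neg_neg, neg_div]

lemma polynomial_eq_zero_of_tendsto_zero {P : Polynomial ℂ} {ι : Type*} {l : Filter ι} [l.NeBot]
    {z : ι → ℂ} (hz : Tendsto (fun i => ‖z i‖) l atTop)
    (h : Tendsto (fun i => P.eval (z i)) l (𝓝 0)) : P = 0 := by
  by_cases hd : 0 < P.degree
  · exact absurd h.norm (not_tendsto_nhds_of_tendsto_atTop
      (P.tendsto_norm_atTop hd hz) _)
  · obtain ⟨a, rfl⟩ : ∃ a, P = Polynomial.C a :=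
      ⟨_, Polynomial.eq_C_of_degree_le_zero (not_lt.1 hd)⟩
    simp only [Polynomial.eval_C] at h
    rw [tendsto_nhds_unique h tendsto_const_nhds |>.symm, Polynomial.C_0]

/-- The leading power of the expansion is smaller than `p + 1`, `p` the genus: along the negative
axis `log Γ(-λ, S)` grows more slowly than `|λ|^{p+1}`. -/
lemma IsSpectralType.leading_power_lt {S : ℕ → ℂ} {θ c : ℝ} {E : ExpansionData}
    (h : IsSpectralType S θ c E) (ha : E.a 0 ≠ 0) : E.α 0 < genus S + 1 := by
  by_contra! hle
  refine ha ?_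
  have hre : ∀ i, 0 < (S i).re := fun i =>
    h.c_pos.trans (lt_re_of_mem_interior h.θ_pos h.θ_lt_pi (h.mem_sector i))
  have hnegnorm : Tendsto (fun t : ℝ => -(t : ℂ)) atTop (cobounded ℂ) := by
    refine tendsto_norm_atTop_iff_cobounded.1 ?_
    simpa using tendsto_abs_atTop_atTop
  have hneg : Tendsto (fun t : ℝ => -(t : ℂ)) atTop
      (cobounded ℂ ⊓ 𝓟 (asymptoticDomain θ c)) := by
    refine tendsto_inf.2 ⟨hnegnorm, tendsto_principal.2 ?_⟩
    filter_upwards [eventually_gt_atTop 0] with t ht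
    rw [mem_asymptoticDomain_iff h.θ_pos h.θ_lt_pi]
    simp only [Complex.neg_re, Complex.ofReal_re, Complex.neg_im, Complex.ofReal_im, neg_zero,
      abs_zero]
    nlinarith [tan_half_pos h.θ_pos h.θ_lt_pi, h.c_pos]
  have h1 := (h.expansion.isLittleO 0 (by simp)).comp_tendsto hneg
  simp only [zero_add, Finset.range_one, Finset.sum_singleton, Function.comp_def, neg_neg,
    norm_neg] at h1
  have h2 : (fun t : ℝ => logGamma S (-(t : ℂ))) =o[atTop] (fun t : ℝ => ‖(t : ℂ)‖ ^ E.α 0) := by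
    refine (logGamma_neg_isLittleO (h.tendsto) h.finite_exponent hre).trans_isBigO ?_
    refine IsBigO.of_bound 1 ?_
    filter_upwards [eventually_ge_atTop 1] with t ht
    have ht' : 1 ≤ ‖(t : ℂ)‖ := by simpa using ht.trans (le_abs_self t)
    rw [norm_pow, one_mul, Real.norm_of_nonneg (by positivity), ← Real.rpow_natCast]
    exact Real.rpow_le_rpow_of_exponent_le ht' (by push_cast; exact hle)
  have h3 := h2.sub h1
  simp only [sub_sub_cancel] at h3
  have hlog : Tendsto (fun t : ℝ => ‖Complex.log (t : ℂ)‖) atTop atTop := by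
    refine Tendsto.congr' ?_ Real.tendsto_log_atTop
    filter_upwards [eventually_ge_atTop 1] with t ht
    rw [← Complex.ofReal_log (by linarith), Complex.norm_real, Real.norm_eq_abs,
      abs_of_nonneg (Real.log_nonneg ht)]
  refine polynomial_eq_zero_of_tendsto_zero hlog ?_
  rw [← isLittleO_one_iff ℝ]
  refine IsLittleO.of_bound fun ε hε => ?_
  filter_upwards [h3.def hε, eventually_gt_atTop 0] with t ht ht0
  have hpos : 0 < ‖(t : ℂ)‖ ^ E.α 0 := Real.rpow_pos_of_pos (by simpa using ht0.ne') _
  rw [norm_mul, Complex.norm_cpow_real, Real.norm_of_nonneg hpos.le] at ht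
  simpa using le_of_mul_le_mul_right ht hpos

/-! ### Shifting the sequence -/

/-- The logarithm is additive along a segment that avoids the cut. -/
lemma log_add_eq_log_add_log {b d : ℂ} (h1 : ∀ t : ℝ, 0 ≤ t → t ≤ 1 → b + t * d ∈ Complex.slitPlane)
    (h2 : ∀ t : ℝ, 0 ≤ t → t ≤ 1 → 1 + t * (d / b) ∈ Complex.slitPlane) :
    Complex.log (b + d) = Complex.log b + Complex.log (1 + d / b) := by
  have hb : b ≠ 0 := by
    have := Complex.slitPlane_ne_zero (h1 0 le_rfl zero_le_one)
    simpa using this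
  have hder : ∀ t : ℝ, 0 ≤ t → t ≤ 1 → HasDerivAt (fun t : ℝ => Complex.log (b + t * d)
      - Complex.log (1 + t * (d / b))) 0 t := by
    intro t ht0 ht1
    have hA : HasDerivAt (fun t : ℝ => b + (t : ℂ) * d) d t := by
      simpa using ((Complex.ofRealCLM.hasDerivAt (x := t)).mul_const d).const_add b
    have hB : HasDerivAt (fun t : ℝ => 1 + (t : ℂ) * (d / b)) (d / b) t := by
      simpa using ((Complex.ofRealCLM.hasDerivAt (x := t)).mul_const (d / b)).const_add 1
    have h := (hA.clog_real (h1 t ht0 ht1)).sub (hB.clog_real (h2 t ht0 ht1))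
    have hz : d / (b + t * d) - d / b / (1 + t * (d / b)) = 0 := by
      have h3 : b + t * d = b * (1 + t * (d / b)) := by field_simp
      rw [h3, div_div, sub_self]
    rwa [hz] at h
  have := constant_of_has_deriv_right_zero (a := 0) (b := 1)
    (fun t ht => (hder t ht.1 ht.2).continuousAt.continuousWithinAt)
    (fun t ht => (hder t ht.1 ht.2.le).hasDerivWithinAt) 1 (by simp)
  simp only [Complex.ofReal_one, one_mul, Complex.ofReal_zero, zero_mul, add_zero,
    Complex.log_one, sub_zero] at this
  rw [← this]; ring

/-- A pointwise convergent series of polynomials of bounded degree sums to a polynomial, as a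
finite-dimensional space of functions is closed for pointwise convergence. -/
lemma exists_polynomial_hasSum {ι : Type*} {D : Set ℂ} {p : ℕ} {P : ι → Polynomial ℂ}
    (hP : ∀ i, (P i).natDegree ≤ p) (hs : ∀ z ∈ D, Summable fun i => (P i).eval z) :
    ∃ q : Polynomial ℂ, q.natDegree ≤ p ∧ ∀ z ∈ D, HasSum (fun i => (P i).eval z) (q.eval z) := by
  let ev : Polynomial ℂ →ₗ[ℂ] (D → ℂ) := LinearMap.pi fun z => Polynomial.leval (z : ℂ)
  let V : Submodule ℂ (D → ℂ) := (Polynomial.degreeLE ℂ p).map ev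
  have hfin : FiniteDimensional ℂ (Polynomial.degreeLE ℂ p) := by
    rw [Polynomial.degreeLE_eq_span_X_pow]
    exact FiniteDimensional.span_finset ℂ _
  have hV : IsClosed (V : Set (D → ℂ)) := Submodule.closed_of_finiteDimensional V
  have hsum : HasSum (fun i => ev (P i)) (fun z : D => ∑' i, (P i).eval (z : ℂ)) :=
    Pi.hasSum.2 fun z => (hs z z.2).hasSum
  have hmem : (fun z : D => ∑' i, (P i).eval (z : ℂ)) ∈ V := by
    refine hV.mem_of_tendsto hsum (Eventually.of_forall fun s => ?_)
    refine Submodule.sum_mem V fun i _ => Submodule.mem_map_of_mem ?_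
    exact Polynomial.mem_degreeLE.2 (Polynomial.degree_le_of_natDegree_le (hP i))
  obtain ⟨q, hq, hqe⟩ := hmem
  refine ⟨q, Polynomial.natDegree_le_of_degree_le (Polynomial.mem_degreeLE.1 hq), fun z hz => ?_⟩
  have : q.eval z = ∑' i, (P i).eval z := congrFun hqe ⟨z, hz⟩
  rw [this]
  exact (hs z hz).hasSum

/-- If `w_k = 1 + μ_k / x`, then `log Γ(-λ, {w_k})` and `log Γ(-x (λ - 1), {μ_k})` differ by a
polynomial whose degree is at most the genus. -/
lemma exists_logGamma_shift {ι : Type*} {μ w : ι → ℂ} {θ θ' c c' x : ℝ} (h0 : 0 < θ) (hθ : θ ≤ θ')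
    (hπ : θ' < Real.pi) (hc : 0 < c) (hc'0 : 0 < c') (hc' : c' ≤ 1) (hx : 0 < x)
    (hμt : Tendsto μ cofinite (cobounded ℂ)) (hμe : FiniteExponent μ)
    (hμ : ∀ k, μ k ∈ spectralSector θ c) (hwt : Tendsto w cofinite (cobounded ℂ))
    (hwe : FiniteExponent w) (hw : ∀ k, w k ∈ spectralSector θ' c')
    (hwμ : ∀ k, w k = 1 + μ k / x) (hg : genus w = genus μ) :
    ∃ q : Polynomial ℂ, q.natDegree ≤ genus μ ∧ ∀ z ∈ asymptoticDomain θ' c',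
      logGamma w z = logGamma μ (x * (z - 1)) - q.eval z := by
  set p := genus μ with hp
  have hxc : (x : ℂ) ≠ 0 := by exact_mod_cast hx.ne'
  have hθπ := hθ.trans_lt hπ
  have hθ'0 := h0.trans_le hθ
  have hμ0 : ∀ k, μ k ≠ 0 := by
    intro k hk
    have := (mem_spectralSector_iff h0 hθπ).1 (hμ k)
    simp only [hk, Complex.zero_im, abs_zero, Complex.zero_re, zero_sub] at this
    nlinarith [tan_half_pos h0 hθπ]
  have hw0 : ∀ k, w k ≠ 0 := by
    intro k hk
    have := (mem_spectralSector_iff hθ'0 hπ).1 (hw k)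
    simp only [hk, Complex.zero_im, abs_zero, Complex.zero_re, zero_sub] at this
    nlinarith [tan_half_pos hθ'0 hπ]
  let T : Polynomial ℂ := ∑ j ∈ Finset.Icc 1 p, Polynomial.monomial j ((-1 : ℂ) ^ j / (j : ℂ))
  have hTdeg : T.natDegree ≤ p := Polynomial.natDegree_sum_le_of_forall_le _ _ fun j hj =>
    (Polynomial.natDegree_monomial_le _).trans (Finset.mem_Icc.1 hj).2
  have hT : ∀ v, logTerm p v = Complex.log (1 + v) + T.eval v := by
    intro v
    simp [logTerm, T, Polynomial.eval_finsetSum]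
  let P : ι → Polynomial ℂ := fun k =>
    T.comp (Polynomial.C (-(w k)⁻¹) * Polynomial.X)
      - T.comp (Polynomial.C (x / μ k) * (1 - Polynomial.X)) + Polynomial.C (T.eval (x / μ k))
  have hcomp : ∀ Q : Polynomial ℂ, Q.natDegree ≤ 1 → (T.comp Q).natDegree ≤ p := fun Q hQ =>
    Polynomial.natDegree_comp_le.trans ((Nat.mul_le_mul hTdeg hQ).trans (by simp))
  have hPdeg : ∀ k, (P k).natDegree ≤ p := by
    intro k
    refine (Polynomial.natDegree_add_le _ _).trans (max_le ((Polynomial.natDegree_sub_le _ _).trans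
      (max_le (hcomp _ ?_) (hcomp _ ?_))) (by simp))
    · exact (Polynomial.natDegree_C_mul_le _ _).trans Polynomial.natDegree_X_le
    · refine (Polynomial.natDegree_C_mul_le _ _).trans ((Polynomial.natDegree_sub_le _ _).trans ?_)
      simp
  -- the identity between the individual terms
  have hterm : ∀ z ∈ asymptoticDomain θ' c', ∀ k, (P k).eval z =
      logTerm p (-z / w k) - logTerm p (-(x * (z - 1)) / μ k) + logTerm p (x / μ k) := by
    intro z hz k
    have hwx : 1 + x / μ k ≠ 0 := by
      have : 1 + x / μ k = x / μ k * w k := by rw [hwμ k]; field_simp [hμ0 k]; ring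
      rw [this]
      exact mul_ne_zero (div_ne_zero hxc (hμ0 k)) (hw0 k)
    have hdw : -(x * z) / μ k / (1 + x / μ k) = -z / w k := by
      have hμk := hμ0 k
      rw [div_eq_div_iff hwx (hw0 k), hwμ k]; field_simp; ring
    have hlog := log_add_eq_log_add_log (b := 1 + x / μ k) (d := -(x * z) / μ k)
      (fun t ht0 ht1 => by
        have hm := one_add_neg_div_mem_slitPlane h0 hθπ hc (mul_sub_one_mem_asymptoticDomain h0 hθ hπ
          hc hc' hx (smul_mem_asymptoticDomain hθ'0 hπ hc'0 hz ht0 ht1)) (hμ k)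
        convert hm using 1; ring)
      (fun t ht0 ht1 => by
        have hm := one_add_neg_div_mem_slitPlane hθ'0 hπ hc'0
          (smul_mem_asymptoticDomain hθ'0 hπ hc'0 hz ht0 ht1) (hw k)
        rw [hdw]
        convert hm using 1; ring)
    rw [hdw] at hlog
    have h5 : 1 + x / μ k + -(x * z) / μ k = 1 + -(x * (z - 1)) / μ k := by ring
    rw [h5] at hlog
    rw [hT, hT, hT, hlog]
    simp only [P, Polynomial.eval_add, Polynomial.eval_sub, Polynomial.eval_comp,
      Polynomial.eval_mul, Polynomial.eval_C, Polynomial.eval_X, Polynomial.eval_one]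
    have h6 : -(w k)⁻¹ * z = -z / w k := by ring
    have h7 : x / μ k * (1 - z) = -(x * (z - 1)) / μ k := by ring
    rw [h6, h7]; ring
  have hsw : ∀ z, Summable fun k => logTerm p (-z / w k) := fun z => by
    rw [← hg]; exact summable_logTerm hwt hwe (-z)
  have hsμ : ∀ z, Summable fun k => logTerm p (z / μ k) := summable_logTerm hμt hμe
  obtain ⟨q, hq, hqs⟩ := exists_polynomial_hasSum (D := asymptoticDomain θ' c') hPdeg
    (fun z hz => (((hsw z).sub (hsμ (-(x * (z - 1))))).add (hsμ x)).congr fun k => (hterm z hz k).symm)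
  refine ⟨q - Polynomial.C (∑' k, logTerm p (x / μ k)),
    (Polynomial.natDegree_sub_le _ _).trans (max_le hq (by simp)), fun z hz => ?_⟩
  have h1 := (hqs z hz).tsum_eq
  rw [tsum_congr (hterm z hz), ((hsw z).sub (hsμ _)).tsum_add (hsμ x),
    (hsw z).tsum_sub (hsμ _)] at h1
  rw [logGamma_eq, logGamma_eq, hg, Polynomial.eval_sub, Polynomial.eval_C, ← h1]
  ring

/-! ### Comparable sequences -/

lemma summable_norm_rpow_of_le {ι : Type*} {S T : ι → ℂ} {A r : ℝ} (hA : 0 < A) (hr : 0 ≤ r)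
    (hT : ∀ i, T i ≠ 0) (h : ∀ i, ‖T i‖ ≤ A * ‖S i‖) (hs : Summable fun i => ‖T i‖ ^ (-r)) :
    Summable fun i => ‖S i‖ ^ (-r) := by
  refine Summable.of_nonneg_of_le (fun i => by positivity) (fun i => ?_) (hs.mul_left (A ^ r))
  have hTi : 0 < ‖T i‖ := norm_pos_iff.2 (hT i)
  have h1 : ‖T i‖ / A ≤ ‖S i‖ := by rw [div_le_iff₀' hA]; exact h i
  refine (Real.rpow_le_rpow_of_nonpos (by positivity) h1 (by linarith)).trans_eq ?_
  rw [Real.div_rpow hTi.le hA.le, Real.rpow_neg hA.le, div_inv_eq_mul, mul_comm]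

/-- Two sequences of non-zero numbers are comparable if the quotients of corresponding moduli are
bounded in both directions. -/
def Comparable {ι : Type*} (S T : ι → ℂ) : Prop :=
  ∃ A : ℝ, 0 < A ∧ ∀ i, S i ≠ 0 ∧ T i ≠ 0 ∧ ‖S i‖ ≤ A * ‖T i‖ ∧ ‖T i‖ ≤ A * ‖S i‖

namespace Comparable

variable {ι : Type*} {S T : ι → ℂ}

lemma summable_iff (h : Comparable S T) {r : ℝ} (hr : 0 ≤ r) :
    (Summable fun i => ‖S i‖ ^ (-r)) ↔ Summable fun i => ‖T i‖ ^ (-r) := by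
  obtain ⟨A, hA, h⟩ := h
  exact ⟨summable_norm_rpow_of_le hA hr (fun i => (h i).1) fun i => (h i).2.2.1,
    summable_norm_rpow_of_le hA hr (fun i => (h i).2.1) fun i => (h i).2.2.2⟩

lemma finiteExponent (h : Comparable S T) (hT : FiniteExponent T) : FiniteExponent S := by
  obtain ⟨r, hr, hs⟩ := hT
  exact ⟨r, hr, (h.summable_iff hr).2 hs⟩

lemma convExponent_eq (h : Comparable S T) : convExponent S = convExponent T := by
  unfold convExponent
  congr 1
  ext r
  exact and_congr_right fun hr => h.summable_iff hr

lemma genus_eq (h : Comparable S T) : genus S = genus T := by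
  unfold genus
  congr 1
  ext p
  have := h.summable_iff (r := (p + 1 : ℕ)) (by positivity)
  simpa only [Set.mem_ofPred_eq, Real.rpow_neg (norm_nonneg _), Real.rpow_natCast] using this

lemma tendsto_cobounded (h : Comparable S T) (hT : Tendsto T cofinite (cobounded ℂ)) :
    Tendsto S cofinite (cobounded ℂ) := by
  obtain ⟨A, hA, h⟩ := h
  refine tendsto_norm_atTop_iff_cobounded.1 (tendsto_atTop_mono (fun i => ?_)
    ((tendsto_norm_cobounded_atTop.comp hT).atTop_div_const hA))
  rw [Function.comp, div_le_iff₀' hA]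
  exact (h i).2.2.2

end Comparable

lemma convExponent_nonneg {ι : Type*} (S : ι → ℂ) : 0 ≤ convExponent S :=
  Real.sInf_nonneg fun _ h => h.1

/-! ### Finite expansions modulo `o(1)` -/

/-- The finite sum `∑_α b_α(log (-λ)) (-λ)^α`. -/
noncomputable def expSum (b : ℝ →₀ Polynomial ℂ) (z : ℂ) : ℂ :=
  b.sum fun α P => P.eval (Complex.log (-z)) * (-z) ^ (α : ℂ)

/-- The coefficient families with powers `α ≥ 0` only, at most linear in the logarithm, the
logarithm occurring with integral powers only. -/
noncomputable def regularData : Submodule ℂ (ℝ →₀ Polynomial ℂ) where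
  carrier := {b | ∀ α, (α < 0 → b α = 0) ∧ (∀ k, k ≠ 0 → k ≠ 1 → (b α).coeff k = 0) ∧
    ((∀ m : ℕ, α ≠ m) → (b α).coeff 1 = 0)}
  zero_mem' := by simp
  add_mem' := by
    intro b b' hb hb' α
    obtain ⟨h1, h2, h3⟩ := hb α
    obtain ⟨h1', h2', h3'⟩ := hb' α
    refine ⟨fun h => ?_, fun k hk hk' => ?_, fun h => ?_⟩
    · rw [Finsupp.add_apply, h1 h, h1' h, add_zero]
    · rw [Finsupp.add_apply, Polynomial.coeff_add, h2 k hk hk', h2' k hk hk', add_zero]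
    · rw [Finsupp.add_apply, Polynomial.coeff_add, h3 h, h3' h, add_zero]
  smul_mem' := by
    intro c b hb α
    obtain ⟨h1, h2, h3⟩ := hb α
    refine ⟨fun h => ?_, fun k hk hk' => ?_, fun h => ?_⟩
    · rw [Finsupp.smul_apply, h1 h, smul_zero]
    · rw [Finsupp.smul_apply, Polynomial.coeff_smul, h2 k hk hk', smul_zero]
    · rw [Finsupp.smul_apply, Polynomial.coeff_smul, h3 h, smul_zero]

/-- `f` has a totally regular expansion with finitely many terms, up to `o(1)` along `l`. -/
def HasFiniteExpansion (l : Filter ℂ) (f : ℂ → ℂ) : Prop :=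
  ∃ b ∈ regularData, (fun z => f z - expSum b z) =o[l] (fun _ => (1 : ℝ))

lemma expSum_add (b b' : ℝ →₀ Polynomial ℂ) (z : ℂ) :
    expSum (b + b') z = expSum b z + expSum b' z :=
  Finsupp.sum_add_index' (by simp) (by intros; rw [Polynomial.eval_add, add_mul])

lemma expSum_smul (c : ℂ) (b : ℝ →₀ Polynomial ℂ) (z : ℂ) :
    expSum (c • b) z = c * expSum b z := by
  rw [expSum, Finsupp.sum_smul_index' (by simp), expSum, Finsupp.mul_sum]
  simp [mul_assoc]

lemma expSum_single (α : ℝ) (P : Polynomial ℂ) (z : ℂ) :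
    expSum (Finsupp.single α P) z = P.eval (Complex.log (-z)) * (-z) ^ (α : ℂ) :=
  Finsupp.sum_single_index (by simp)

lemma single_mem_regularData {α : ℝ} (hα : 0 ≤ α) {P : Polynomial ℂ}
    (hP : ∀ k, k ≠ 0 → k ≠ 1 → P.coeff k = 0) (h1 : (∀ m : ℕ, α ≠ m) → P.coeff 1 = 0) :
    Finsupp.single α P ∈ regularData := by
  intro β
  by_cases h : α = β
  · subst h
    simpa [hα.not_gt] using ⟨hP, h1⟩
  · simp [Finsupp.single_eq_of_ne' h]

namespace HasFiniteExpansion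

variable {l : Filter ℂ} {f g : ℂ → ℂ}

lemma add (hf : HasFiniteExpansion l f) (hg : HasFiniteExpansion l g) :
    HasFiniteExpansion l (fun z => f z + g z) := by
  obtain ⟨b, hb, h⟩ := hf
  obtain ⟨b', hb', h'⟩ := hg
  refine ⟨b + b', add_mem hb hb', (h.add h').congr_left fun z => ?_⟩
  rw [expSum_add]; ring

lemma const_mul (hf : HasFiniteExpansion l f) (c : ℂ) :
    HasFiniteExpansion l (fun z => c * f z) := by
  obtain ⟨b, hb, h⟩ := hf
  refine ⟨c • b, regularData.smul_mem c hb, (h.const_mul_left c).congr_left fun z => ?_⟩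
  rw [expSum_smul]; ring

lemma of_isLittleO (h : f =o[l] (fun _ => (1 : ℝ))) : HasFiniteExpansion l f :=
  ⟨0, zero_mem _, by simpa [expSum] using h⟩

lemma congr (hf : HasFiniteExpansion l f) (h : f =ᶠ[l] g) : HasFiniteExpansion l g := by
  obtain ⟨b, hb, h'⟩ := hf
  exact ⟨b, hb, h'.congr' (h.mono fun z hz => by simp only [hz]) EventuallyEq.rfl⟩

lemma sum {ι : Type*} {s : Finset ι} {F : ι → ℂ → ℂ} (h : ∀ i ∈ s, HasFiniteExpansion l (F i)) :
    HasFiniteExpansion l (fun z => ∑ i ∈ s, F i z) := by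
  classical
  induction s using Finset.induction_on with
  | empty => exact of_isLittleO (by simpa using isLittleO_zero (E' := ℂ) (fun _ => (1 : ℝ)) l)
  | insert i s hi ih =>
    simp only [Finset.sum_insert hi]
    exact (h i (Finset.mem_insert_self i s)).add
      (ih fun j hj => h j (Finset.mem_insert_of_mem hj))

end HasFiniteExpansion

lemma norm_rpow_isLittleO_one {l : Filter ℂ} (hl : l ≤ cobounded ℂ) {β : ℝ} (hβ : β < 0) :
    (fun z : ℂ => ‖z‖ ^ β) =o[l] (fun _ => (1 : ℝ)) := by
  rw [isLittleO_one_iff]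
  have := tendsto_rpow_neg_atTop (neg_pos.2 hβ)
  rw [neg_neg] at this
  exact this.comp (tendsto_norm_cobounded_atTop.mono_left hl)

lemma neg_cpow_isBigO (l : Filter ℂ) (β : ℝ) :
    (fun z : ℂ => (-z) ^ (β : ℂ)) =O[l] (fun z : ℂ => ‖z‖ ^ β) :=
  IsBigO.of_norm_le fun z => by rw [Complex.norm_cpow_real, norm_neg]

lemma hasFiniteExpansion_neg_cpow {l : Filter ℂ} (hl : l ≤ cobounded ℂ) (β : ℝ) :
    HasFiniteExpansion l (fun z => (-z) ^ (β : ℂ)) := by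
  rcases lt_or_ge β 0 with h | h
  · exact .of_isLittleO ((neg_cpow_isBigO l β).trans_isLittleO (norm_rpow_isLittleO_one hl h))
  · refine ⟨Finsupp.single β 1, single_mem_regularData h (fun k hk _ => ?_) (fun _ => ?_), ?_⟩
    · rw [Polynomial.coeff_one, if_neg hk]
    · rw [Polynomial.coeff_one, if_neg one_ne_zero]
    · simpa [expSum_single] using isLittleO_zero (E' := ℂ) (fun _ => (1 : ℝ)) l

lemma hasFiniteExpansion_neg_pow_mul_log (l : Filter ℂ) (m : ℕ) :
    HasFiniteExpansion l (fun z => (-z) ^ m * Complex.log (-z)) := by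
  refine ⟨Finsupp.single (m : ℝ) Polynomial.X, single_mem_regularData (Nat.cast_nonneg m)
    (fun k _ hk => ?_) (fun h => absurd rfl (h m)), ?_⟩
  · rw [Polynomial.coeff_X, if_neg (Ne.symm hk)]
  · refine (isLittleO_zero _ _).congr_left fun z => ?_
    rw [expSum_single, Polynomial.eval_X, Complex.ofReal_natCast, Complex.cpow_natCast]; ring

lemma hasFiniteExpansion_polynomial {l : Filter ℂ} (hl : l ≤ cobounded ℂ) (q : Polynomial ℂ) :
    HasFiniteExpansion l (fun z => q.eval z) := by
  have h : HasFiniteExpansion l (fun z => ∑ j ∈ Finset.range (q.natDegree + 1),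
      (q.coeff j * (-1) ^ j) * (-z) ^ ((j : ℝ) : ℂ)) :=
    .sum fun j _ => (hasFiniteExpansion_neg_cpow hl j).const_mul _
  refine h.congr (Eventually.of_forall fun z => ?_)
  simp only
  rw [Polynomial.eval_eq_sum_range]
  refine Finset.sum_congr rfl fun j _ => ?_
  rw [Complex.ofReal_natCast, Complex.cpow_natCast, mul_assoc, ← mul_pow]
  simp

/-- Taylor's expansion of `h` at the origin turns `(-λ)^β h(-1/λ)` into a sum of powers. -/
lemma hasFiniteExpansion_neg_cpow_mul {l : Filter ℂ} (hl : l ≤ cobounded ℂ) (β : ℝ) {h : ℂ → ℂ}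
    (hh : AnalyticAt ℂ h 0) :
    HasFiniteExpansion l (fun z => (-z) ^ (β : ℂ) * h (-z)⁻¹) := by
  -- with `n > β` terms the remainder `(-λ)^(β - n)` tends to zero
  set n := ⌈β⌉₊ + 1 with hn
  have hβn : β - n < 0 := by
    have := Nat.le_ceil β
    rw [hn]; push_cast; linarith
  obtain ⟨G, hG, hhG⟩ := hh.exists_eventuallyEq_sum_add_pow_mul n
  have hinv : Tendsto (fun z : ℂ => (-z)⁻¹) l (𝓝 0) :=
    (tendsto_inv₀_cobounded.comp (tendsto_neg_cobounded.mono_left hl))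
  have hne : ∀ᶠ z : ℂ in l, -z ≠ 0 := by
    filter_upwards [(tendsto_norm_cobounded_atTop.mono_left hl).eventually_gt_atTop 0] with z hz
    exact neg_ne_zero.2 (norm_pos_iff.1 hz)
  have hpow : ∀ z : ℂ, -z ≠ 0 → ∀ i : ℕ,
      (-z) ^ ((β - i : ℝ) : ℂ) = (-z) ^ (β : ℂ) * ((-z)⁻¹) ^ i := by
    intro z hz i
    rw [Complex.ofReal_sub, Complex.cpow_sub _ _ hz, Complex.ofReal_natCast, Complex.cpow_natCast,
      inv_pow, div_eq_mul_inv]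
  have h1 : HasFiniteExpansion l (fun z => ∑ i ∈ Finset.range n,
      ((i.factorial : ℂ)⁻¹ * iteratedDeriv i h 0) * (-z) ^ ((β - i : ℝ) : ℂ)) :=
    .sum fun i _ => (hasFiniteExpansion_neg_cpow hl _).const_mul _
  have h2 : HasFiniteExpansion l (fun z => (-z) ^ ((β - n : ℝ) : ℂ) * G (-z)⁻¹) := by
    refine .of_isLittleO (IsBigO.trans_isLittleO ?_ (norm_rpow_isLittleO_one hl hβn))
    simpa using (neg_cpow_isBigO l (β - n)).mul
      ((hG.continuousAt.isBigO_one ℝ).comp_tendsto hinv)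
  refine (h1.add h2).congr ?_
  filter_upwards [hne, hinv.eventually hhG] with z hz hz'
  rw [hz', hpow z hz n, mul_add, Finset.mul_sum]
  congr 1
  · refine Finset.sum_congr rfl fun i _ => ?_
    rw [hpow z hz i, smul_eq_mul]; ring
  · rw [smul_eq_mul]; ring

lemma add_ofReal_mem_slitPlane {z : ℂ} (hz : z ∈ Complex.slitPlane) {t : ℝ} (ht : 0 ≤ t) :
    z + t ∈ Complex.slitPlane := by
  rw [Complex.mem_slitPlane_iff] at hz ⊢
  rcases hz with h | h
  · left; simp; linarith
  · right; simpa using h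

lemma log_add_one {z : ℂ} (hz : z ∈ Complex.slitPlane) :
    Complex.log (1 + z) = Complex.log z + Complex.log (1 + z⁻¹) := by
  have h := log_add_eq_log_add_log (b := z) (d := 1)
    (fun t ht _ => by simpa using add_ofReal_mem_slitPlane hz ht) (fun t ht _ => by
      rcases ht.eq_or_lt with rfl | ht
      · simp
      have h2 : (t : ℂ) * z⁻¹ ∈ Complex.slitPlane := by
        have hn : 0 < Complex.normSq z := Complex.normSq_pos.2 (Complex.slitPlane_ne_zero hz)
        rw [Complex.mem_slitPlane_iff, Complex.re_ofReal_mul, Complex.im_ofReal_mul,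
          Complex.inv_re, Complex.inv_im]
        rcases Complex.mem_slitPlane_iff.1 hz with h | h
        · exact Or.inl (by positivity)
        · exact Or.inr (mul_ne_zero ht.ne' (div_ne_zero (neg_ne_zero.2 h) hn.ne'))
      have h3 := add_ofReal_mem_slitPlane h2 zero_le_one
      rwa [Complex.ofReal_one, add_comm, ← one_div] at h3)
  rw [add_comm, h, one_div]

lemma one_add_cpow {z : ℂ} (hz : z ∈ Complex.slitPlane) (hz1 : 1 + z ≠ 0) (β : ℂ) :
    (1 + z) ^ β = z ^ β * (1 + z⁻¹) ^ β := by
  have hz0 := Complex.slitPlane_ne_zero hz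
  have h1 : 1 + z⁻¹ ≠ 0 := by
    intro h
    apply hz1
    have : 1 + z = z * (1 + z⁻¹) := by field_simp; ring
    rw [this, h, mul_zero]
  rw [Complex.cpow_def_of_ne_zero hz1, Complex.cpow_def_of_ne_zero hz0,
    Complex.cpow_def_of_ne_zero h1, log_add_one hz, add_mul, Complex.exp_add]

lemma hasFiniteExpansion_one_sub_cpow {l : Filter ℂ} (hl : l ≤ cobounded ℂ)
    (hsl : ∀ᶠ z in l, -z ∈ Complex.slitPlane) (β : ℝ) :
    HasFiniteExpansion l (fun z => (1 - z) ^ (β : ℂ)) := by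
  have hh : AnalyticAt ℂ (fun u : ℂ => (1 + u) ^ (β : ℂ)) 0 := by
    refine AnalyticAt.cpow (by fun_prop) analyticAt_const (by simp)
  refine (hasFiniteExpansion_neg_cpow_mul hl β hh).congr ?_
  filter_upwards [hsl, (tendsto_norm_cobounded_atTop.mono_left hl).eventually_gt_atTop 1]
    with z hz hz1
  have : 1 + -z ≠ 0 := by
    intro h
    have : z = 1 := by linear_combination -h
    simp [this] at hz1
  rw [sub_eq_add_neg, one_add_cpow hz this]

/-- The binomial formula yields integral powers with `log (-λ)`, and `log (1 - 1/λ)` only powers. -/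
lemma hasFiniteExpansion_one_sub_pow_mul_log {l : Filter ℂ} (hl : l ≤ cobounded ℂ)
    (hsl : ∀ᶠ z in l, -z ∈ Complex.slitPlane) (m : ℕ) :
    HasFiniteExpansion l (fun z => (1 - z) ^ m * Complex.log (1 - z)) := by
  have hh : AnalyticAt ℂ (fun u : ℂ => (1 + u) ^ m * Complex.log (1 + u)) 0 := by
    refine AnalyticAt.mul (by fun_prop) (AnalyticAt.clog (by fun_prop) (by simp))
  have h1 : HasFiniteExpansion l (fun z => ∑ i ∈ Finset.range (m + 1),
      (m.choose i : ℂ) * ((-z) ^ i * Complex.log (-z))) :=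
    .sum fun i _ => (hasFiniteExpansion_neg_pow_mul_log l i).const_mul _
  refine (h1.add (hasFiniteExpansion_neg_cpow_mul hl m hh)).congr ?_
  filter_upwards [hsl] with z hz
  have hz0 := Complex.slitPlane_ne_zero hz
  have h2 : (1 - z) ^ m = ∑ i ∈ Finset.range (m + 1), (m.choose i : ℂ) * (-z) ^ i := by
    rw [sub_eq_add_neg, add_comm, add_pow]
    simp [mul_comm]
  have h3 : (-z) ^ m * (1 + (-z)⁻¹) ^ m = (1 - z) ^ m := by
    rw [← mul_pow, mul_add, mul_inv_cancel₀ hz0]; congr 1; ring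
  rw [Complex.ofReal_natCast, Complex.cpow_natCast, ← mul_assoc, h3]
  have h4 : Complex.log (1 - z) = Complex.log (-z) + Complex.log (1 + (-z)⁻¹) := by
    rw [sub_eq_add_neg, log_add_one hz]
  rw [h4, mul_add]
  congr 1
  rw [h2, Finset.sum_mul]
  simp only [mul_assoc]

/-- A power with a polynomial in the logarithm is dominated by every larger power. -/
lemma eval_log_mul_cpow_isLittleO (P : Polynomial ℂ) {β γ : ℝ} (h : β < γ) :
    (fun z : ℂ => P.eval (Complex.log (-z)) * (-z) ^ (β : ℂ)) =o[cobounded ℂ]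
      (fun z : ℂ => ‖z‖ ^ γ) := by
  have hnorm : Tendsto (fun w : ℂ => ‖w‖) (cobounded ℂ) atTop := tendsto_norm_cobounded_atTop
  have hlog : ∀ k : ℕ, (fun z : ℂ => Complex.log (-z) ^ k) =o[cobounded ℂ]
      (fun z : ℂ => ‖z‖ ^ (γ - β)) := by
    intro k
    have h1 := (isLittleO_log_rpow_rpow_atTop (k : ℝ) (sub_pos.2 h)).comp_tendsto hnorm
    refine IsBigO.trans_isLittleO (IsBigO.of_bound (2 ^ k) ?_) h1
    filter_upwards [(Real.tendsto_log_atTop.comp hnorm).eventually_ge_atTop Real.pi] with z hz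
    simp only [Function.comp] at hz ⊢
    have h0 : 0 ≤ Real.log ‖z‖ := Real.pi_pos.le.trans hz
    rw [Real.rpow_natCast, norm_pow, norm_pow, ← mul_pow, Real.norm_of_nonneg h0]
    refine pow_le_pow_left₀ (norm_nonneg _) ?_ k
    refine (norm_log_le_abs_log_norm_add_pi _).trans ?_
    rw [norm_neg, abs_of_nonneg h0]; linarith
  have hP : (fun z : ℂ => P.eval (Complex.log (-z))) =o[cobounded ℂ]
      (fun z : ℂ => ‖z‖ ^ (γ - β)) := by
    simp only [Polynomial.eval_eq_sum_range]
    exact IsLittleO.fun_sum fun k _ => (hlog k).const_mul_left _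
  refine (hP.mul_isBigO (neg_cpow_isBigO _ β)).congr' EventuallyEq.rfl ?_
  filter_upwards [hnorm.eventually_gt_atTop 0] with z hz
  rw [← Real.rpow_add hz, sub_add_cancel]

/-- The terms of a finite expansion, arranged by decreasing powers and completed by the power `0`,
form an expansion of order `0`. -/
lemma HasFiniteExpansion.exists_expansionData {S : ℕ → ℂ} {θ c : ℝ}
    (h : HasFiniteExpansion (cobounded ℂ ⊓ 𝓟 (asymptoticDomain θ c)) (logGamma S)) :
    ∃ E : ExpansionData, HasLogGammaExpansion S θ c E ∧ E.order ≤ 0 ∧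
      (∀ j : ℕ, (j : ℕ∞) ≤ E.N → ∀ k : ℕ, k ≠ 0 → k ≠ 1 → (E.a j).coeff k = 0) ∧
      (∀ j : ℕ, (j : ℕ∞) ≤ E.N → (E.a j).coeff 1 ≠ 0 → ∃ m : ℕ, E.α j = (m : ℝ)) := by
  obtain ⟨b, hb, hbo⟩ := h
  set A : Finset ℝ := insert 0 b.support with hA
  have hA0 : ∀ α ∈ A, 0 ≤ α := by
    intro α hα
    rcases Finset.mem_insert.1 hα with rfl | hα
    · exact le_rfl
    · by_contra hneg
      exact Finsupp.mem_support_iff.1 hα ((hb α).1 (not_le.1 hneg))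
  obtain ⟨N, hN⟩ : ∃ N, A.card = N + 1 :=
    Nat.exists_eq_succ_of_ne_zero (Finset.card_ne_zero.2 ⟨0, Finset.mem_insert_self _ _⟩)
  let e := A.orderEmbOfFin hN
  let α : ℕ → ℝ := fun j => e (Fin.rev (Fin.ofNat (N + 1) j))
  have hαdec : ∀ i j : ℕ, i < j → j ≤ N → α j < α i := by
    intro i j hij hj
    refine e.strictMono (Fin.rev_lt_rev.2 ?_)
    rw [Fin.lt_def, Fin.val_ofNat, Fin.val_ofNat, Nat.mod_eq_of_lt (by omega),
      Nat.mod_eq_of_lt (by omega)]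
    exact hij
  have hαmem : ∀ j, α j ∈ A := fun j => A.orderEmbOfFin_mem hN _
  have hinj : Set.InjOn α (Finset.range (N + 1)) := by
    intro i hi j hj hij
    have hi := Finset.mem_range.1 (Finset.mem_coe.1 hi)
    have hj := Finset.mem_range.1 (Finset.mem_coe.1 hj)
    rcases lt_trichotomy i j with h | h | h
    · exact absurd hij (hαdec i j h (by omega)).ne'
    · exact h
    · exact absurd hij (hαdec j i h (by omega)).ne
  have hαN : α N = 0 := by
    refine le_antisymm ?_ (hA0 _ (hαmem N))
    obtain ⟨i, hi⟩ : ∃ i, e i = 0 := by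
      have : (0 : ℝ) ∈ Set.range e := by
        rw [Finset.range_orderEmbOfFin]; exact Finset.mem_coe.2 (Finset.mem_insert_self _ _)
      exact this
    rw [← hi]
    refine e.monotone ?_
    rw [Fin.le_def, Fin.val_rev, Fin.val_ofNat, Nat.mod_eq_of_lt (by omega)]
    omega
  have hsum : ∀ z, expSum b z = ∑ j ∈ Finset.range (N + 1),
      (b (α j)).eval (Complex.log (-z)) * (-z) ^ ((α j : ℝ) : ℂ) := by
    intro z
    have h1 : expSum b z = ∑ β ∈ A, (b β).eval (Complex.log (-z)) * (-z) ^ ((β : ℝ) : ℂ) :=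
      Finsupp.sum_of_support_subset b (Finset.subset_insert _ _) _ (by simp)
    have himg : A = (Finset.range (N + 1)).image α := by
      symm
      refine Finset.eq_of_subset_of_card_le (Finset.image_subset_iff.2 fun j _ => hαmem j) ?_
      rw [Finset.card_image_of_injOn hinj, Finset.card_range, hN]
    rw [h1, himg, Finset.sum_image hinj]
  refine ⟨⟨N, α, fun j => b (α j)⟩, ⟨fun i j hij hj => hαdec i j hij (Nat.cast_le.1 hj),
    fun h => absurd h (by simp), fun M hM => ?_⟩, ?_, fun j _ => (hb (α j)).2.1, fun j _ h => ?_⟩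
  · have hM : M ≤ N := Nat.cast_le.1 hM
    have hlow : (fun _ : ℂ => (1 : ℝ)) =O[cobounded ℂ ⊓ 𝓟 (asymptoticDomain θ c)]
        (fun z : ℂ => ‖z‖ ^ α M) := by
      refine IsBigO.of_bound 1 ?_
      filter_upwards [(tendsto_norm_cobounded_atTop.mono_left
        (inf_le_left (b := 𝓟 (asymptoticDomain θ c)))).eventually_ge_atTop 1] with z hz
      rw [norm_one, one_mul, Real.norm_of_nonneg (by positivity)]
      exact Real.one_le_rpow hz (hA0 _ (hαmem M))
    have htail : (fun z : ℂ => ∑ j ∈ Finset.Ico (M + 1) (N + 1),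
        (b (α j)).eval (Complex.log (-z)) * (-z) ^ ((α j : ℝ) : ℂ))
        =o[cobounded ℂ ⊓ 𝓟 (asymptoticDomain θ c)] (fun z : ℂ => ‖z‖ ^ α M) := by
      refine IsLittleO.fun_sum fun j hj => ?_
      have hj := Finset.mem_Ico.1 hj
      exact (eval_log_mul_cpow_isLittleO _ (hαdec M j (by omega) (by omega))).mono inf_le_left
    refine ((hbo.trans_isBigO hlow).add htail).congr_left fun z => ?_
    rw [hsum, ← Finset.sum_range_add_sum_Ico _ (by omega : M + 1 ≤ N + 1)]
    ring
  · simp only [ExpansionData.order]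
    rw [if_neg (by simp)]
    simp [hαN]
  · by_contra! hne
    exact h ((hb (α j)).2.2 hne)

/-! ### The expansion after the shift -/

lemma eval_eq_of_coeff {P : Polynomial ℂ} (hP : ∀ k, k ≠ 0 → k ≠ 1 → P.coeff k = 0) (y : ℂ) :
    P.eval y = P.coeff 0 + P.coeff 1 * y := by
  have h : P = Polynomial.C (P.coeff 0) + Polynomial.C (P.coeff 1) * Polynomial.X := by
    ext k
    rcases k with _ | _ | k
    · simp
    · simp
    · rw [hP _ (by omega) (by omega)]
      simp
  conv_lhs => rw [h]
  simp

lemma ofReal_mul_cpow {x : ℝ} (hx : 0 < x) {y : ℂ} (hy : y ≠ 0) (α : ℂ) :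
    ((x : ℂ) * y) ^ α = (x : ℂ) ^ α * y ^ α := by
  have hxc : (x : ℂ) ≠ 0 := by exact_mod_cast hx.ne'
  rw [Complex.cpow_def_of_ne_zero (mul_ne_zero hxc hy), Complex.cpow_def_of_ne_zero hxc,
    Complex.cpow_def_of_ne_zero hy, Complex.log_ofReal_mul hx hy, Complex.ofReal_log hx.le, add_mul,
    Complex.exp_add]

/-- Scaling the argument of a term of a regular expansion produces one additional term, which
carries `log x`. -/
lemma eval_log_mul_cpow_scale {P : Polynomial ℂ} (hP : ∀ k, k ≠ 0 → k ≠ 1 → P.coeff k = 0) {x : ℝ}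
    (hx : 0 < x) {y : ℂ} (hy : y ≠ 0) (α : ℂ) :
    P.eval (Complex.log (x * y)) * ((x : ℂ) * y) ^ α =
      (x : ℂ) ^ α * (P.eval (Complex.log y) * y ^ α)
        + P.coeff 1 * Real.log x * (x : ℂ) ^ α * y ^ α := by
  rw [ofReal_mul_cpow hx hy, Complex.log_ofReal_mul hx hy, eval_eq_of_coeff hP, eval_eq_of_coeff hP]
  ring

lemma eventually_neg_mem_slitPlane {θ c : ℝ} (h0 : 0 < θ) (hπ : θ < Real.pi) (hc : c ≤ 1) :
    ∀ᶠ z : ℂ in cobounded ℂ ⊓ 𝓟 (asymptoticDomain θ c), -z ∈ Complex.slitPlane := by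
  filter_upwards [(tendsto_norm_cobounded_atTop.mono_left
    (inf_le_left (b := 𝓟 (asymptoticDomain θ c)))).eventually_gt_atTop 1,
    mem_inf_of_right (mem_principal_self (asymptoticDomain θ c))] with z hz1 hz
  rw [mem_asymptoticDomain_iff h0 hπ] at hz
  rw [Complex.mem_slitPlane_iff_not_le_zero]
  intro hle
  obtain ⟨hre, him⟩ := Complex.le_def.1 hle
  simp only [Complex.neg_re, Complex.zero_re, Complex.neg_im, Complex.zero_im, neg_eq_zero,
    Left.neg_nonpos_iff] at hre him
  have hzr : z = (z.re : ℂ) := Complex.ext (by simp) (by simpa using him)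
  rw [hzr, Complex.norm_real, Real.norm_of_nonneg hre] at hz1
  rw [him, abs_zero] at hz
  nlinarith [tan_half_pos h0 hπ]

lemma tendsto_mul_sub_one {θ θ' c c' x : ℝ} (h0 : 0 < θ) (hθ : θ ≤ θ')
    (hπ : θ' < Real.pi) (hc : 0 < c) (hc' : c' ≤ 1) (hx : 0 < x) :
    Tendsto (fun z : ℂ => (x : ℂ) * (z - 1)) (cobounded ℂ ⊓ 𝓟 (asymptoticDomain θ' c'))
      (cobounded ℂ ⊓ 𝓟 (asymptoticDomain θ c)) := by
  refine tendsto_inf.2 ⟨Tendsto.mono_left ?_ inf_le_left, tendsto_principal.2 ?_⟩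
  · refine tendsto_norm_atTop_iff_cobounded.1 ?_
    simp only [norm_mul, Complex.norm_real, Real.norm_of_nonneg hx.le]
    refine Tendsto.const_mul_atTop hx (tendsto_atTop_mono (fun z => ?_)
      (tendsto_atTop_add_const_right _ (-1) (tendsto_norm_cobounded_atTop (E := ℂ))))
    have := norm_sub_norm_le z 1
    rw [norm_one] at this
    linarith
  · filter_upwards [mem_inf_of_right (mem_principal_self (asymptoticDomain θ' c'))] with z hz
    exact mul_sub_one_mem_asymptoticDomain h0 hθ hπ hc hc' hx hz

/-! ### The sequence `1 + μ_k / x` -/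

lemma one_add_div_mem_interior {θ θ' c c' x : ℝ} (h0 : 0 < θ) (hθ : θ ≤ θ') (hπ : θ' < Real.pi)
    (hc : 0 < c) (hc' : c' ≤ 1) (hx : 0 < x) {μ : ℂ} (hμ : μ ∈ interior (spectralSector θ c)) :
    1 + μ / x ∈ interior (spectralSector θ' c') := by
  have hre := lt_re_of_mem_interior h0 (hθ.trans_lt hπ) hμ
  rw [mem_interior_spectralSector_iff h0 (hθ.trans_lt hπ)] at hμ
  rw [mem_interior_spectralSector_iff (h0.trans_le hθ) hπ]
  have ht := tan_half_pos h0 (hθ.trans_lt hπ)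
  have htt := tan_half_mono h0 hθ hπ
  rw [Complex.add_im, Complex.add_re, Complex.div_ofReal_im, Complex.div_ofReal_re,
    Complex.one_im, Complex.one_re, zero_add, abs_div, abs_of_pos hx, div_lt_iff₀ hx]
  have h1 : Real.tan (θ' / 2) * (1 + μ.re / x - c') * x
      = Real.tan (θ' / 2) * (μ.re + x * (1 - c')) := by field_simp; ring
  rw [h1]
  have h2 : Real.tan (θ / 2) * μ.re ≤ Real.tan (θ' / 2) * μ.re :=
    mul_le_mul_of_nonneg_right htt (hc.trans hre).le
  have h3 : 0 ≤ Real.tan (θ' / 2) * (x * (1 - c')) :=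
    mul_nonneg (ht.le.trans htt) (mul_nonneg hx.le (by linarith))
  nlinarith [mul_pos ht hc]

lemma one_le_norm_one_add_div {x : ℝ} (hx : 0 < x) {μ : ℂ} (hμ : 0 ≤ μ.re) :
    1 ≤ ‖1 + μ / x‖ := by
  refine le_trans ?_ ((le_abs_self _).trans (Complex.abs_re_le_norm _))
  rw [Complex.add_re, Complex.div_ofReal_re, Complex.one_re]
  have := div_nonneg hμ hx.le
  linarith

lemma norm_le_norm_ofReal_add {x : ℝ} (hx : 0 ≤ x) {μ : ℂ} (hμ : 0 ≤ μ.re) :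
    x ≤ ‖(x : ℂ) + μ‖ ∧ ‖μ‖ ≤ ‖(x : ℂ) + μ‖ := by
  constructor
  · refine le_trans ?_ ((le_abs_self _).trans (Complex.abs_re_le_norm _))
    simpa using hμ
  · rw [← sq_le_sq₀ (norm_nonneg _) (norm_nonneg _), Complex.sq_norm, Complex.sq_norm,
      Complex.normSq_apply, Complex.normSq_apply]
    simp only [Complex.add_re, Complex.ofReal_re, Complex.add_im, Complex.ofReal_im, zero_add]
    nlinarith [mul_nonneg hx hμ]

/-- The sequences `μ_k` and `x + μ_k` are comparable. -/
lemma comparable_ofReal_add {ι : Type*} {μ : ι → ℂ} {c x : ℝ} (hc : 0 < c) (hx : 0 < x)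
    (hμ : ∀ k, c < (μ k).re) : Comparable (fun k => (x : ℂ) + μ k) μ := by
  refine ⟨1 + x / c, by positivity, fun k => ?_⟩
  have hre : 0 < (μ k).re := hc.trans (hμ k)
  have h1 := norm_le_norm_ofReal_add hx.le hre.le
  have hcμ : c ≤ ‖μ k‖ := (hμ k).le.trans ((le_abs_self _).trans (Complex.abs_re_le_norm _))
  refine ⟨norm_pos_iff.1 (hx.trans_le h1.1), norm_pos_iff.1 (hc.trans_le hcμ), ?_, ?_⟩
  · refine (norm_add_le _ _).trans ?_
    rw [Complex.norm_real, Real.norm_of_nonneg hx.le, add_mul, one_mul, div_mul_eq_mul_div]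
    have : x ≤ x * ‖μ k‖ / c := by
      rw [le_div_iff₀ hc]; exact mul_le_mul_of_nonneg_left hcμ hx.le
    linarith
  · refine h1.2.trans (le_mul_of_one_le_left (norm_nonneg _) ?_)
    have : 0 ≤ x / c := by positivity
    linarith

lemma comparable_one_add_div {ι : Type*} {μ : ι → ℂ} {c x : ℝ} (hc : 0 < c) (hx : 0 < x)
    (hμ : ∀ k, c < (μ k).re) : Comparable (fun k => 1 + μ k / x) μ := by
  obtain ⟨A, hA, h⟩ := comparable_ofReal_add hc hx hμ
  have hxc : (x : ℂ) ≠ 0 := by exact_mod_cast hx.ne'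
  have hn : ∀ k, ‖1 + μ k / x‖ = ‖(x : ℂ) + μ k‖ / x := by
    intro k
    have : 1 + μ k / x = ((x : ℂ) + μ k) / x := by field_simp
    rw [this, norm_div, Complex.norm_real, Real.norm_of_nonneg hx.le]
  refine ⟨A * (x + 1 / x), by positivity, fun k => ?_⟩
  obtain ⟨h1, h2, h3, h4⟩ := h k
  refine ⟨?_, h2, ?_, ?_⟩
  · rw [← norm_pos_iff, hn]
    have := norm_pos_iff.2 h1
    positivity
  · rw [hn, div_le_iff₀ hx]
    have : A * (x + 1 / x) * ‖μ k‖ * x = A * ‖μ k‖ + A * ‖μ k‖ * x ^ 2 := by field_simp; ring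
    rw [this]
    have : 0 ≤ A * ‖μ k‖ * x ^ 2 := by positivity
    linarith
  · rw [hn]
    have : A * (x + 1 / x) * (‖(x : ℂ) + μ k‖ / x)
        = A * ‖(x : ℂ) + μ k‖ + A * ‖(x : ℂ) + μ k‖ / x ^ 2 := by field_simp
    rw [this]
    have : 0 ≤ A * ‖(x : ℂ) + μ k‖ / x ^ 2 := by positivity
    linarith

/-! ### Total regularity of the shifted sequence -/

lemma IsSpectralType.re_gt {S : ℕ → ℂ} {θ c : ℝ} {E : ExpansionData} (h : IsSpectralType S θ c E)
    (k : ℕ) : c < (S k).re :=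
  lt_re_of_mem_interior h.θ_pos h.θ_lt_pi (h.mem_sector k)

lemma IsSpectralType.exists_shift {μ : ℕ → ℂ} {θ θ' c c' x : ℝ} {E : ExpansionData}
    (h : IsSpectralType μ θ c E) (hθ : θ ≤ θ') (hπ : θ' < Real.pi) (hc'0 : 0 < c') (hc' : c' ≤ 1)
    (hx : 0 < x) :
    ∃ q : Polynomial ℂ, q.natDegree ≤ genus μ ∧ ∀ z ∈ asymptoticDomain θ' c',
      logGamma (fun k => 1 + μ k / x) z = logGamma μ (x * (z - 1)) - q.eval z := by
  have hcomp := comparable_one_add_div h.c_pos hx h.re_gt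
  exact exists_logGamma_shift h.θ_pos hθ hπ h.c_pos hc'0 hc' hx h.tendsto h.finite_exponent
    (fun k => interior_subset (h.mem_sector k)) (hcomp.tendsto_cobounded h.tendsto)
    (hcomp.finiteExponent h.finite_exponent)
    (fun k => interior_subset (one_add_div_mem_interior h.θ_pos hθ hπ h.c_pos hc' hx
      (h.mem_sector k))) (fun _ => rfl) hcomp.genus_eq

/-- For `α` not a natural number the hypothesis leaves only the pure power `(1 - λ)^α`. -/
lemma hasFiniteExpansion_term {l : Filter ℂ} (hl : l ≤ cobounded ℂ)
    (hsl : ∀ᶠ z in l, -z ∈ Complex.slitPlane) {P : Polynomial ℂ}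
    (hP : ∀ k, k ≠ 0 → k ≠ 1 → P.coeff k = 0) {α : ℝ} (hα : P.coeff 1 ≠ 0 → ∃ m : ℕ, α = m) :
    HasFiniteExpansion l (fun z => P.eval (Complex.log (1 - z)) * (1 - z) ^ (α : ℂ)) := by
  have h1 := (hasFiniteExpansion_one_sub_cpow hl hsl α).const_mul (P.coeff 0)
  by_cases h0 : P.coeff 1 = 0
  · refine h1.congr (Eventually.of_forall fun z => ?_)
    simp only [eval_eq_of_coeff hP, h0, zero_mul, add_zero]
  · obtain ⟨m, rfl⟩ := hα h0
    refine (h1.add ((hasFiniteExpansion_one_sub_pow_mul_log hl hsl m).const_mul (P.coeff 1))).congr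
      (Eventually.of_forall fun z => ?_)
    simp only [eval_eq_of_coeff hP, Complex.ofReal_natCast, Complex.cpow_natCast]
    ring

lemma exists_power_nonpos {S : ℕ → ℂ} {θ c : ℝ} {E : ExpansionData}
    (h : HasLogGammaExpansion S θ c E) (hE : E.order ≤ 0) : ∃ M : ℕ, (M : ℕ∞) ≤ E.N ∧ E.α M ≤ 0 := by
  by_cases hN : E.N = ⊤
  · obtain ⟨M, hM⟩ := ((h.infinite hN).eventually_le_atBot 0).exists
    exact ⟨M, by simp [hN], hM⟩
  · refine ⟨E.N.toNat, (ENat.natCast_toNat hN).le, ?_⟩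
    rw [ExpansionData.order, if_neg hN] at hE
    exact_mod_cast hE

/-- The rescaled and shifted sequence `1 + μ_k / x` is again totally regular, of order `≤ 0`. -/
lemma IsTotallyRegular.shift {μ : ℕ → ℂ} {θ c c' x : ℝ} {E : ExpansionData}
    (h : IsTotallyRegular μ θ c E) (hE : E.order ≤ 0) (hc'0 : 0 < c') (hc' : c' ≤ 1) (hx : 0 < x) :
    ∃ F : ExpansionData, IsTotallyRegular (fun k => 1 + μ k / x) θ c' F ∧ F.order ≤ 0 := by
  have hcomp := comparable_one_add_div h.c_pos hx h.re_gt
  obtain ⟨q, -, hq⟩ := h.exists_shift le_rfl h.θ_lt_pi hc'0 hc' hx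
  obtain ⟨M, hMN, hM⟩ := exists_power_nonpos h.expansion hE
  set l := cobounded ℂ ⊓ 𝓟 (asymptoticDomain θ c') with hldef
  have hl : l ≤ cobounded ℂ := inf_le_left
  have hmem : ∀ᶠ z in l, z ∈ asymptoticDomain θ c' := mem_inf_of_right (mem_principal_self _)
  have hsl : ∀ᶠ z in l, -z ∈ Complex.slitPlane :=
    eventually_neg_mem_slitPlane h.θ_pos h.θ_lt_pi hc'
  have htend := tendsto_mul_sub_one h.θ_pos le_rfl h.θ_lt_pi h.c_pos hc' hx
  have hrem := (h.expansion.isLittleO M hMN).comp_tendsto htend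
  have hrem1 : HasFiniteExpansion l (fun z => logGamma μ (x * (z - 1))
      - ∑ j ∈ Finset.range (M + 1), (E.a j).eval (Complex.log (-(x * (z - 1))))
        * (-(x * (z - 1))) ^ ((E.α j : ℝ) : ℂ)) := by
    refine .of_isLittleO (hrem.trans_isBigO ?_)
    refine IsBigO.of_bound 1 ?_
    filter_upwards [((tendsto_norm_cobounded_atTop.mono_left inf_le_left).comp
      htend).eventually_ge_atTop 1] with z hz
    simp only [Function.comp] at hz ⊢
    rw [norm_one, one_mul, Real.norm_of_nonneg (by positivity)]
    exact Real.rpow_le_one_of_one_le_of_nonpos hz hM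
  have hterms : HasFiniteExpansion l (fun z => ∑ j ∈ Finset.range (M + 1),
      (E.a j).eval (Complex.log (-(x * (z - 1)))) * (-(x * (z - 1))) ^ ((E.α j : ℝ) : ℂ)) := by
    refine .sum fun j hj => ?_
    have hjN : (j : ℕ∞) ≤ E.N := le_trans (by
      exact_mod_cast Nat.lt_succ_iff.1 (Finset.mem_range.1 hj)) hMN
    refine (((hasFiniteExpansion_term hl hsl (h.regular j hjN) (h.totally j hjN)).const_mul
      ((x : ℂ) ^ ((E.α j : ℝ) : ℂ))).add ((hasFiniteExpansion_one_sub_cpow hl hsl (E.α j)).const_mul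
      ((E.a j).coeff 1 * Real.log x * (x : ℂ) ^ ((E.α j : ℝ) : ℂ)))).congr ?_
    filter_upwards [hmem] with z hz
    have hz1 := Complex.slitPlane_ne_zero (one_sub_mem_slitPlane h.θ_pos h.θ_lt_pi hc' hz)
    have hneg : -((x : ℂ) * (z - 1)) = x * (1 - z) := by ring
    rw [hneg, eval_log_mul_cpow_scale (h.regular j hjN) hx hz1]
  have hall : HasFiniteExpansion l (logGamma fun k => 1 + μ k / x) := by
    refine ((hrem1.add hterms).add ((hasFiniteExpansion_polynomial hl q).const_mul (-1))).congr ?_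
    filter_upwards [hmem] with z hz
    rw [hq z hz]; ring
  obtain ⟨F, hF1, hF2, hF3, hF4⟩ := hall.exists_expansionData
  have hint := fun k => one_add_div_mem_interior h.θ_pos le_rfl h.θ_lt_pi h.c_pos hc' hx
    (h.mem_sector k)
  refine ⟨F, ?_, hF2⟩
  exact
    { ne_zero := fun k hk => by
        have := one_le_norm_one_add_div hx (h.c_pos.trans (h.re_gt k)).le
        rw [hk, norm_zero] at this
        linarith
      tendsto := hcomp.tendsto_cobounded h.tendsto
      finite_exponent := hcomp.finiteExponent h.finite_exponent
      lt_genus := by rw [hcomp.convExponent_eq, hcomp.genus_eq]; exact h.lt_genus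
      c_pos := hc'0
      θ_pos := h.θ_pos
      θ_lt_pi := h.θ_lt_pi
      mem_sector := hint
      expansion := hF1
      regular := hF3
      totally := hF4 }

/-! ### The uniform expansion -/

/-- The term of index `h` of the expansion, evaluated at `-λ` replaced by `1 - λ` and with its
Taylor polynomial of degree `p` at `λ = 0` removed. -/
noncomputable def shiftedTerm (E : ExpansionData) (p h : ℕ) (z : ℂ) : ℂ :=
  (E.a h).eval (Complex.log (1 - z)) * (1 - z) ^ ((E.α h : ℝ) : ℂ)
    - (taylorPoly p fun u => (E.a h).eval (Complex.log (1 - u))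
        * (1 - u) ^ ((E.α h : ℝ) : ℂ)).eval z

lemma differentiableOn_term (P : Polynomial ℂ) (α : ℂ) :
    DifferentiableOn ℂ (fun u => P.eval (Complex.log (1 - u)) * (1 - u) ^ α) (Metric.ball 0 1) := by
  intro z hz
  have hsl : 1 - z ∈ Complex.slitPlane := by
    rw [sub_eq_add_neg]
    exact Complex.mem_slitPlane_of_norm_lt_one (by simpa using hz)
  refine DifferentiableAt.differentiableWithinAt ?_
  have h1 : DifferentiableAt ℂ (fun u : ℂ => Complex.log (1 - u)) z :=
    DifferentiableAt.clog (by fun_prop) hsl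
  exact (P.differentiable.differentiableAt.comp z h1).mul
    (DifferentiableAt.cpow (by fun_prop) (by fun_prop) hsl)

lemma differentiableOn_shiftedTerm (E : ExpansionData) (p h : ℕ) :
    DifferentiableOn ℂ (shiftedTerm E p h) (Metric.ball 0 1) :=
  (differentiableOn_term _ _).sub (Polynomial.differentiable _).differentiableOn

lemma shiftedTerm_isBigO (E : ExpansionData) (p h : ℕ) :
    shiftedTerm E p h =O[𝓝 0] (fun z : ℂ => z ^ (p + 1)) :=
  isBigO_sub_taylorPoly
    ((differentiableOn_term _ _).analyticAt (Metric.ball_mem_nhds 0 one_pos)) p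

/-- A logarithmic term is a power `m ≤ p`; the term with `log x` which it produces after scaling is
a polynomial of degree at most `p`. -/
lemma exists_polynomial_log_term {P : Polynomial ℂ} {α : ℝ} {p : ℕ}
    (hα : P.coeff 1 ≠ 0 → ∃ m : ℕ, m ≤ p ∧ α = m) (b : ℂ) :
    ∃ Q : Polynomial ℂ, Q.natDegree ≤ p ∧ ∀ z, Q.eval z = P.coeff 1 * b * (1 - z) ^ (α : ℂ) := by
  by_cases h0 : P.coeff 1 = 0
  · exact ⟨0, by simp, fun z => by simp [h0]⟩
  · obtain ⟨m, hm, rfl⟩ := hα h0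
    refine ⟨Polynomial.C (P.coeff 1 * b) * (1 - Polynomial.X) ^ m,
      (Polynomial.natDegree_C_mul_le _ _).trans (Polynomial.natDegree_pow_le.trans ?_), fun z => ?_⟩
    · have : (1 - Polynomial.X : Polynomial ℂ).natDegree ≤ 1 :=
        (Polynomial.natDegree_sub_le _ _).trans (by simp)
      nlinarith
    · simp

/-- The expansion of `log Γ(-λ, {1 + μ_k / x})` for `x → ∞`, uniformly in `λ`. The error is the
remainder `r` of the expansion of `log Γ(-λ, {μ_k})` at `x (λ - 1)`, corrected by its Taylor
polynomial at `λ = 0`, which Cauchy's estimate controls. -/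
lemma IsTotallyRegular.uniform_expansion {μ : ℕ → ℂ} {θ θ' c c' r₀ : ℝ} {E : ExpansionData} {ℓ : ℕ}
    (h : IsTotallyRegular μ θ c E) (hθ : θ ≤ θ') (hπ : θ' < Real.pi) (hc'0 : 0 < c') (hc' : c' < 1)
    (hr₀ : 0 ≤ r₀) (hℓ : (ℓ : ℕ∞) ≤ E.N) (hlead : E.a 0 ≠ 0)
    (hrem : (fun lam : ℂ => logGamma μ lam - ∑ j ∈ Finset.range (ℓ + 1),
        (E.a j).eval (Complex.log (-lam)) * (-lam) ^ ((E.α j : ℝ) : ℂ))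
      =o[cobounded ℂ ⊓ 𝓟 (asymptoticDomain θ c)] (fun lam : ℂ => ‖lam‖ ^ (-r₀)))
    {ε : ℝ} (hε : 0 < ε) :
    ∃ X : ℝ, ∀ x : ℝ, 0 < x → X ≤ x → ∀ z ∈ asymptoticDomain θ' c',
      ‖logGamma (fun k => 1 + μ k / x) z - ∑ j ∈ Finset.range (ℓ + 1),
          shiftedTerm E (genus μ) j z * (x : ℂ) ^ ((E.α j : ℝ) : ℂ)‖
        ≤ ε * x ^ (-r₀) * (1 + ‖z‖) ^ genus μ := by
  set p := genus μ with hp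
  set rem : ℂ → ℂ := fun lam => logGamma μ lam - ∑ j ∈ Finset.range (ℓ + 1),
        (E.a j).eval (Complex.log (-lam)) * (-lam) ^ ((E.α j : ℝ) : ℂ) with hremdef
  have hθ'0 := h.θ_pos.trans_le hθ
  have hjN : ∀ j ∈ Finset.range (ℓ + 1), (j : ℕ∞) ≤ E.N := fun j hj => le_trans (by
      exact_mod_cast Nat.lt_succ_iff.1 (Finset.mem_range.1 hj)) hℓ
  -- logarithms occur with powers `m ≤ p` only, as all powers are smaller than `p + 1`
  have hlogpow : ∀ j ∈ Finset.range (ℓ + 1), (E.a j).coeff 1 ≠ 0 → ∃ m : ℕ, m ≤ p ∧ E.α j = m := by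
    intro j hj h1
    obtain ⟨m, hm⟩ := h.totally j (hjN j hj) h1
    have hlt : E.α j < p + 1 := by
      refine lt_of_le_of_lt ?_ (h.leading_power_lt hlead)
      rcases Nat.eq_zero_or_pos j with rfl | hpos
      · exact le_rfl
      · exact (h.expansion.decreasing 0 j hpos (hjN j hj)).le
    rw [hm] at hlt
    exact ⟨m, Nat.lt_succ_iff.1 (by exact_mod_cast hlt), hm⟩
  obtain ⟨δ, hδ, hδz⟩ := exists_le_norm_sub_one hθ'0 hπ hc'
  -- the disc of radius `η` lies in the domain and inside the disc where Taylor's expansion converges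
  set η : ℝ := min (1 / 4) (c' / 2) with hη
  have hη0 : 0 < η := lt_min (by norm_num) (by linarith)
  have hη1 : η < 1 / 2 := (min_le_left _ _).trans_lt (by norm_num)
  have hηc : η < c' := (min_le_right _ _).trans_lt (by linarith)
  set K : ℝ := ∑ j ∈ Finset.range (p + 1), (η ^ j)⁻¹ with hK
  have hK0 : 0 ≤ K := Finset.sum_nonneg fun j _ => by positivity
  have hδr : 0 < δ ^ (-r₀) := Real.rpow_pos_of_pos hδ _
  -- `K` bounds the Taylor polynomial against the remainder, `δ` comes from `|x (λ - 1)| ≥ δ x`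
  set ε' : ℝ := ε / ((1 + K) * δ ^ (-r₀)) with hε'
  have hε'0 : 0 < ε' := by positivity
  obtain ⟨B, hB⟩ : ∃ B : ℝ, ∀ lam ∈ asymptoticDomain θ c, B ≤ ‖lam‖ →
      ‖rem lam‖ ≤ ε' * ‖lam‖ ^ (-r₀) := by
    have h1 := hrem.def hε'0
    rw [eventually_inf_principal, ← comap_norm_atTop, eventually_comap] at h1
    obtain ⟨B, hB⟩ := eventually_atTop.1 h1
    refine ⟨B, fun lam hlam hle => ?_⟩
    have := hB _ hle lam rfl hlam
    rwa [Real.norm_of_nonneg (by positivity)] at this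
  refine ⟨B / δ, fun x hx hXx => ?_⟩
  set M : ℝ := ε' * (δ ^ (-r₀) * x ^ (-r₀)) with hM
  have hM0 : 0 ≤ M := by positivity
  have hremM : ∀ z ∈ asymptoticDomain θ' c', ‖rem (x * (z - 1))‖ ≤ M := by
    intro z hz
    have hn : δ * x ≤ ‖(x : ℂ) * (z - 1)‖ := by
      rw [norm_mul, Complex.norm_real, Real.norm_of_nonneg hx.le, mul_comm]
      exact mul_le_mul_of_nonneg_left (hδz z hz) hx.le
    have hBx : B ≤ δ * x := by rwa [div_le_iff₀' hδ] at hXx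
    refine (hB _ (mul_sub_one_mem_asymptoticDomain h.θ_pos hθ hπ h.c_pos hc'.le hx hz)
      (hBx.trans hn)).trans ?_
    rw [hM, ← Real.mul_rpow hδ.le hx.le]
    exact mul_le_mul_of_nonneg_left
      (Real.rpow_le_rpow_of_nonpos (by positivity) hn (by linarith)) hε'0.le
  obtain ⟨q, hqdeg, hq⟩ := h.exists_shift hθ hπ hc'0 hc'.le hx
  have hlogQ : ∀ j : ℕ, ∃ Q : Polynomial ℂ, j ∈ Finset.range (ℓ + 1) → Q.natDegree ≤ p ∧
      ∀ z, Q.eval z = (E.a j).coeff 1 * (Real.log x * (x : ℂ) ^ ((E.α j : ℝ) : ℂ))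
        * (1 - z) ^ ((E.α j : ℝ) : ℂ) := by
    intro j
    by_cases hj : j ∈ Finset.range (ℓ + 1)
    · obtain ⟨Q, hQ⟩ := exists_polynomial_log_term (hlogpow j hj)
        (Real.log x * (x : ℂ) ^ ((E.α j : ℝ) : ℂ))
      exact ⟨Q, fun _ => hQ⟩
    · exact ⟨0, fun h => absurd h hj⟩
  choose QL hQL using hlogQ
  -- the polynomial by which the error differs from `rem (x (λ - 1))`
  let Q : Polynomial ℂ := q - ∑ j ∈ Finset.range (ℓ + 1),
    (Polynomial.C ((x : ℂ) ^ ((E.α j : ℝ) : ℂ)) * taylorPoly p (fun u =>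
      (E.a j).eval (Complex.log (1 - u)) * (1 - u) ^ ((E.α j : ℝ) : ℂ)) + QL j)
  have hQdeg : Q.natDegree ≤ p := by
    refine (Polynomial.natDegree_sub_le _ _).trans (max_le hqdeg
      (Polynomial.natDegree_sum_le_of_forall_le _ _ fun j hj => ?_))
    exact (Polynomial.natDegree_add_le _ _).trans (max_le
      ((Polynomial.natDegree_C_mul_le _ _).trans (natDegree_taylorPoly_le _ _)) (hQL j hj).1)
  set R : ℂ → ℂ := fun z => logGamma (fun k => 1 + μ k / x) z - ∑ j ∈ Finset.range (ℓ + 1),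
    shiftedTerm E p j z * (x : ℂ) ^ ((E.α j : ℝ) : ℂ) with hR
  have hRQ : ∀ z ∈ asymptoticDomain θ' c', R z + Q.eval z = rem (x * (z - 1)) := by
    intro z hz
    have hz1 := Complex.slitPlane_ne_zero (one_sub_mem_slitPlane hθ'0 hπ hc'.le hz)
    have hneg : -((x : ℂ) * (z - 1)) = x * (1 - z) := by ring
    have hsum : ∑ j ∈ Finset.range (ℓ + 1), (E.a j).eval (Complex.log (-(x * (z - 1))))
          * (-(x * (z - 1))) ^ ((E.α j : ℝ) : ℂ)
        = ∑ j ∈ Finset.range (ℓ + 1), shiftedTerm E p j z * (x : ℂ) ^ ((E.α j : ℝ) : ℂ)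
          + ∑ j ∈ Finset.range (ℓ + 1), (Polynomial.C ((x : ℂ) ^ ((E.α j : ℝ) : ℂ)) *
            taylorPoly p (fun u => (E.a j).eval (Complex.log (1 - u))
              * (1 - u) ^ ((E.α j : ℝ) : ℂ)) + QL j).eval z := by
      rw [← Finset.sum_add_distrib]
      refine Finset.sum_congr rfl fun j hj => ?_
      rw [hneg, eval_log_mul_cpow_scale (h.regular j (hjN j hj)) hx hz1, Polynomial.eval_add,
        Polynomial.eval_mul, Polynomial.eval_C, (hQL j hj).2, shiftedTerm]
      ring
    simp only [hR, hremdef, Q]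
    rw [hsum, hq z hz, Polynomial.eval_sub, Polynomial.eval_finsetSum]
    ring
  have hcomp := comparable_one_add_div h.c_pos hx h.re_gt
  obtain ⟨hdiff, hbig⟩ := logGamma_near_zero (hcomp.tendsto_cobounded h.tendsto)
    (hcomp.finiteExponent h.finite_exponent)
    (fun k => one_le_norm_one_add_div hx (h.c_pos.trans (h.re_gt k)).le)
  rw [hcomp.genus_eq] at hbig
  have hRdiff : DifferentiableOn ℂ R (Metric.ball 0 (1 / 2)) := by
    refine hdiff.sub (DifferentiableOn.fun_sum fun j _ => DifferentiableOn.mul_const ?_ _)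
    exact (differentiableOn_shiftedTerm E p j).mono (Metric.ball_subset_ball (by norm_num))
  have hRbig : R =O[𝓝 0] (fun z : ℂ => z ^ (p + 1)) := by
    refine hbig.sub (IsBigO.fun_sum fun j _ => ?_)
    refine ((shiftedTerm_isBigO E p j).const_mul_left
      ((x : ℂ) ^ ((E.α j : ℝ) : ℂ))).congr_left fun z => mul_comm _ _
  have hQbd := norm_eval_le_of_isBigO_sub (f := fun z => R z + Q.eval z) (q := Q) (p := p) (M := M)
    hη0 hη1 (hRdiff.add Q.differentiable.differentiableOn) hQdeg
    (by simpa only [add_sub_cancel_right] using hRbig) (fun z hz => by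
      have hz' : z ∈ asymptoticDomain θ' c' :=
        ball_subset_asymptoticDomain hθ'0 hπ (by simpa [hz] using hηc)
      rw [hRQ z hz']
      exact hremM z hz')
  intro z hz
  have hRz : R z = rem (x * (z - 1)) - Q.eval z := by rw [← hRQ z hz]; ring
  change ‖R z‖ ≤ _
  rw [hRz]
  have h1 : (1 : ℝ) ≤ (1 + ‖z‖) ^ p := one_le_pow₀ (by linarith [norm_nonneg z])
  have hMK : (1 + K) * M = ε * x ^ (-r₀) := by
    rw [hM, hε']; field_simp
  calc ‖rem (x * (z - 1)) - Q.eval z‖ ≤ M + K * M * (1 + ‖z‖) ^ p :=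
        (norm_sub_le _ _).trans (add_le_add (hremM z hz) (hQbd z))
    _ ≤ M * (1 + ‖z‖) ^ p + K * M * (1 + ‖z‖) ^ p := by
        gcongr; exact le_mul_of_one_le_right hM0 h1
    _ = ε * x ^ (-r₀) * (1 + ‖z‖) ^ p := by rw [← hMK]; ring

/-! ### The sum of two sequences -/

lemma exists_isGreatest_length {S : ℕ → ℂ} {θ c r : ℝ} {E : ExpansionData}
    (h : HasLogGammaExpansion S θ c E) (h0 : -E.α 0 ≤ r) :
    ∃ ℓ : ℕ, IsGreatest {h : ℕ | (h : ℕ∞) ≤ E.N ∧ -E.α h ≤ r} ℓ := by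
  have hbdd : BddAbove {h : ℕ | (h : ℕ∞) ≤ E.N ∧ -E.α h ≤ r} := by
    by_cases hN : E.N = ⊤
    · obtain ⟨B, hB⟩ := eventually_atTop.1 ((h.infinite hN).eventually_lt_atBot (-r))
      refine ⟨B, fun j hj => ?_⟩
      by_contra! hlt
      linarith [hB j hlt.le, hj.2]
    · refine ⟨E.N.toNat, fun j hj => ?_⟩
      have := hj.1
      rw [← ENat.natCast_toNat hN] at this
      exact_mod_cast this
  exact ⟨_, Nat.sSup_mem ⟨0, by simp, h0⟩ hbdd, fun j hj => le_csSup hbdd hj⟩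

/-- Up to the length `ℓ` the remainder of the expansion is `o(|λ|^{-r})`: either the expansion ends
with the power `-r`, or the next power is smaller than `-r` and carries no logarithm. -/
lemma IsTotallyRegular.remainder_isLittleO {S : ℕ → ℂ} {θ c r : ℝ} {E : ExpansionData} {ℓ : ℕ}
    (h : IsTotallyRegular S θ c E) (hord : (r : EReal) ≤ -E.order)
    (hℓ : IsGreatest {h : ℕ | (h : ℕ∞) ≤ E.N ∧ -E.α h ≤ r} ℓ) :
    (fun lam : ℂ => logGamma S lam - ∑ j ∈ Finset.range (ℓ + 1),
        (E.a j).eval (Complex.log (-lam)) * (-lam) ^ ((E.α j : ℝ) : ℂ))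
      =o[cobounded ℂ ⊓ 𝓟 (asymptoticDomain θ c)] (fun lam : ℂ => ‖lam‖ ^ (-r)) := by
  obtain ⟨⟨hℓN, hℓr⟩, hmax⟩ := hℓ
  rcases hℓN.eq_or_lt with heq | hlt
  · have hα : E.α ℓ = -r := by
      rw [ExpansionData.order, if_neg (by rw [← heq]; exact ENat.natCast_ne_top ℓ), ← heq,
        ENat.toNat_natCast] at hord
      have : r ≤ -E.α ℓ := by exact_mod_cast hord
      linarith
    have h1 := h.expansion.isLittleO ℓ hℓN
    rwa [hα] at h1
  · have hsucc : ((ℓ + 1 : ℕ) : ℕ∞) ≤ E.N := by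
      push_cast; exact Order.add_one_le_of_lt hlt
    have hα : E.α (ℓ + 1) < -r := by
      by_contra! hge
      have : ℓ + 1 ≤ ℓ := hmax ⟨hsucc, by linarith⟩
      omega
    have hpow : (fun lam : ℂ => ‖lam‖ ^ E.α (ℓ + 1)) =O[cobounded ℂ ⊓ 𝓟 (asymptoticDomain θ c)]
        (fun lam : ℂ => ‖lam‖ ^ (-r)) := by
      refine IsBigO.of_bound 1 ?_
      filter_upwards [(tendsto_norm_cobounded_atTop.mono_left
        (inf_le_left (b := 𝓟 (asymptoticDomain θ c)))).eventually_ge_atTop 1] with z hz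
      rw [one_mul, Real.norm_of_nonneg (by positivity), Real.norm_of_nonneg (by positivity)]
      exact Real.rpow_le_rpow_of_exponent_le hz hα.le
    have h1 := ((h.expansion.isLittleO (ℓ + 1) hsucc).trans_isBigO hpow).add
      ((eval_log_mul_cpow_isLittleO (E.a (ℓ + 1)) hα).mono inf_le_left)
    refine h1.congr_left fun z => ?_
    rw [Finset.sum_range_succ _ (ℓ + 1)]
    ring

lemma tendsto_double_sequence {x : ℕ → ℝ} {μ : ℕ → ℂ} (hx0 : ∀ n, 0 < x n) (hμ0 : ∀ k, 0 < (μ k).re)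
    (hx : Tendsto (fun n => (x n : ℂ)) cofinite (cobounded ℂ))
    (hμ : Tendsto μ cofinite (cobounded ℂ)) :
    Tendsto (fun q : ℕ × ℕ => (x q.1 : ℂ) + μ q.2) cofinite (cobounded ℂ) := by
  refine tendsto_norm_atTop_iff_cobounded.1 (tendsto_atTop.2 fun R => ?_)
  have h1 : {n | ¬ R ≤ ‖(x n : ℂ)‖}.Finite := eventually_le_norm hx R
  have h2 : {k | ¬ R ≤ ‖μ k‖}.Finite := eventually_le_norm hμ R
  refine (h1.prod h2).subset fun q hq => ?_
  have hle := norm_le_norm_ofReal_add (hx0 q.1).le (hμ0 q.2).le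
  have hxn : ‖(x q.1 : ℂ)‖ = x q.1 := by
    rw [Complex.norm_real, Real.norm_of_nonneg (hx0 q.1).le]
  exact ⟨fun h => hq ((h.trans_eq hxn).trans hle.1), fun h => hq (h.trans hle.2)⟩

lemma finiteExponent_double_sequence {x : ℕ → ℝ} {μ : ℕ → ℂ} (hx0 : ∀ n, 0 < x n)
    (hμ0 : ∀ k, 0 < (μ k).re) (hx : FiniteExponent (fun n => (x n : ℂ))) (hμ : FiniteExponent μ) :
    FiniteExponent (fun q : ℕ × ℕ => (x q.1 : ℂ) + μ q.2) := by
  obtain ⟨r, hr, hrs⟩ := hx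
  obtain ⟨s, hs, hss⟩ := hμ
  refine ⟨r + s, add_nonneg hr hs, ?_⟩
  refine Summable.of_nonneg_of_le (fun q => by positivity) (fun q => ?_)
    (hrs.mul_of_nonneg hss (fun _ => by positivity) (fun _ => by positivity))
  have hle := norm_le_norm_ofReal_add (hx0 q.1).le (hμ0 q.2).le
  have hxn : ‖(x q.1 : ℂ)‖ = x q.1 := by
    rw [Complex.norm_real, Real.norm_of_nonneg (hx0 q.1).le]
  have hμn : 0 < ‖μ q.2‖ :=
    (hμ0 q.2).trans_le ((le_abs_self _).trans (Complex.abs_re_le_norm _))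
  rw [neg_add, Real.rpow_add ((hx0 q.1).trans_le hle.1), hxn]
  exact mul_le_mul (Real.rpow_le_rpow_of_nonpos (hx0 q.1) hle.1 (by linarith))
    (Real.rpow_le_rpow_of_nonpos hμn hle.2 (by linarith)) (by positivity)
    (Real.rpow_nonneg (hx0 q.1).le _)

/-- For fixed `μ` the sequence `x_n + μ` is comparable to `x_n`. -/
lemma comparable_add_const {x : ℕ → ℝ} {μ : ℂ} {c : ℝ} (hc : 0 < c) (hx : ∀ n, c < x n)
    (hμ : 0 ≤ μ.re) : Comparable (fun n => (x n : ℂ) + μ) (fun n => (x n : ℂ)) := by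
  refine ⟨1 + ‖μ‖ / c, by positivity, fun n => ?_⟩
  have hx0 := hc.trans (hx n)
  have hle := norm_le_norm_ofReal_add hx0.le hμ
  have hxn : ‖(x n : ℂ)‖ = x n := by rw [Complex.norm_real, Real.norm_of_nonneg hx0.le]
  refine ⟨norm_pos_iff.1 (hx0.trans_le hle.1), Complex.ofReal_ne_zero.2 hx0.ne', ?_, ?_⟩
  · refine (norm_add_le _ _).trans ?_
    rw [hxn, add_mul, one_mul]
    have : ‖μ‖ ≤ ‖μ‖ / c * x n := by
      rw [div_mul_eq_mul_div, le_div_iff₀ hc]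
      exact mul_le_mul_of_nonneg_left (hx n).le (norm_nonneg μ)
    linarith
  · rw [hxn]
    refine hle.1.trans (le_mul_of_one_le_left (norm_nonneg _) ?_)
    have : 0 ≤ ‖μ‖ / c := by positivity
    linarith

theorem mainTheorem2
    (lam₁ : ℕ → ℝ) (lam₂ : ℕ → ℂ) (θ₁ c₁ θ₂ c₂ : ℝ) (E₁ E₂ : ExpansionData)
    (h₁ : IsTotallyRegular (fun n => (lam₁ n : ℂ)) θ₁ c₁ E₁)
    (h₂ : IsTotallyRegular lam₂ θ₂ c₂ E₂)
    -- the first power listed in the expansion of `log Γ(-λ, S₂)` does occur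
    (hlead : E₂.a 0 ≠ 0)
    -- some power satisfies the inequality that defines the length
    (hα₂ : -E₂.α 0 ≤ convExponent (fun n => (lam₁ n : ℂ)))
    (hord₁ : E₁.order < ((-(genus lam₂ : ℝ) - 1 : ℝ) : EReal))
    (hord₂ : ((convExponent (fun n => (lam₁ n : ℂ)) : ℝ) : EReal) ≤ -E₂.order) :
    ∃ ℓ : ℕ,
      IsGreatest {h : ℕ | (h : ℕ∞) ≤ E₂.N ∧ -E₂.α h ≤ convExponent (fun n => (lam₁ n : ℂ))} ℓ ∧
      ∀ c' : ℝ, 0 < c' → c' < 1 →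
        IsSpectrallyDecomposable (fun n₁ n₂ => (lam₁ n₁ : ℂ) + lam₂ n₂)
          (fun n => (lam₁ n : ℂ)) 1 ℓ (max θ₁ θ₂) (min (min c₁ c₂) (min c₁ c')) := by
  obtain ⟨ℓ, hℓ⟩ := exists_isGreatest_length h₂.expansion hα₂
  refine ⟨ℓ, hℓ, fun c' hc'0 hc' => ?_⟩
  set r₀ := convExponent (fun n => (lam₁ n : ℂ))
  have hr₀ : 0 ≤ r₀ := convExponent_nonneg _
  have hx : ∀ n, c₁ < lam₁ n := fun n => by simpa using h₁.re_gt n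
  have hx0 : ∀ n, 0 < lam₁ n := fun n => h₁.c_pos.trans (hx n)
  have hμ0 : ∀ k, 0 < (lam₂ k).re := fun k => h₂.c_pos.trans (h₂.re_gt k)
  have hcompx : ∀ k, Comparable (fun n => (lam₁ n : ℂ) + lam₂ k) (fun n => (lam₁ n : ℂ)) :=
    fun k => comparable_add_const h₁.c_pos hx (hμ0 k).le
  have hcompμ : ∀ n, Comparable (fun k => (lam₁ n : ℂ) + lam₂ k) lam₂ :=
    fun n => comparable_ofReal_add h₂.c_pos (hx0 n) h₂.re_gt
  have hscale : ∀ n, (fun k => (lam₁ n : ℂ) ^ (-((1 : ℝ) : ℂ)) * ((lam₁ n : ℂ) + lam₂ k))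
      = fun k => 1 + lam₂ k / lam₁ n := by
    intro n
    have : (lam₁ n : ℂ) ≠ 0 := by exact_mod_cast (hx0 n).ne'
    funext k
    rw [Complex.ofReal_one, Complex.cpow_neg_one]
    field_simp
  have hθπ : max θ₁ θ₂ < Real.pi := max_lt h₁.θ_lt_pi h₂.θ_lt_pi
  have hord₂' : E₂.order ≤ 0 := by
    have : (0 : EReal) ≤ -E₂.order := le_trans (by exact_mod_cast hr₀) hord₂
    simpa using this
  have hp0 : (0 : ℝ) ≤ genus lam₂ := Nat.cast_nonneg _
  have hαdec : ∀ i j : ℕ, i < j → j ≤ ℓ → E₂.α j < E₂.α i := fun i j hij hj =>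
    h₂.expansion.decreasing i j hij (le_trans (by exact_mod_cast hj) hℓ.1.1)
  refine ⟨one_pos, r₀, convExponent lam₂, genus (fun n => (lam₁ n : ℂ)), genus lam₂, θ₂, min c₁ c₂,
    θ₁, c₁, θ₂, c', E₁, ?_, tendsto_double_sequence hx0 hμ0 h₁.tendsto h₂.tendsto,
    finiteExponent_double_sequence hx0 hμ0 h₁.finite_exponent h₂.finite_exponent, fun k => ?_,
    fun n => ?_, lt_min h₁.c_pos h₂.c_pos, h₂.θ_pos, h₂.θ_lt_pi, fun n k => ?_, h₁, ?_, rfl, ?_,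
    fun n => ?_, ?_⟩
  · intro n k
    exact norm_pos_iff.1 ((hx0 n).trans_le (norm_le_norm_ofReal_add (hx0 n).le (hμ0 k).le).1)
  · exact ⟨(hcompx k).finiteExponent h₁.finite_exponent, (hcompx k).convExponent_eq,
      (hcompx k).genus_eq⟩
  · exact ⟨(hcompμ n).finiteExponent h₂.finite_exponent, (hcompμ n).convExponent_eq,
      (hcompμ n).genus_eq⟩
  · have hs := (mem_interior_spectralSector_iff h₂.θ_pos h₂.θ_lt_pi).1 (h₂.mem_sector k)
    rw [mem_interior_spectralSector_iff h₂.θ_pos h₂.θ_lt_pi]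
    simp only [Complex.add_im, Complex.ofReal_im, zero_add, Complex.add_re, Complex.ofReal_re]
    refine hs.trans_le (mul_le_mul_of_nonneg_left ?_ (tan_half_pos h₂.θ_pos h₂.θ_lt_pi).le)
    linarith [min_le_right c₁ c₂, hx0 n]
  · refine hord₁.le.trans ?_
    have : -(genus lam₂ : ℝ) - 1 ≤ 0 := by linarith
    exact_mod_cast this
  · rw [max_left_comm, max_self]
  · rw [hscale]
    exact h₂.shift hord₂' hc'0 hc'.le (hx0 n)
  -- the terms with `log x_n` drop out, as the logarithms come with powers not exceeding the genus
  refine ⟨0, fun h => -E₂.α h, fun _ => 0, fun h => shiftedTerm E₂ (genus lam₂) h, fun _ => 0,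
    fun i j hij => neg_lt_neg (hαdec i j hij (Nat.lt_succ_iff.1 j.2)), Subsingleton.strictMono (α := Fin 1) _,
    fun h => ?_, fun _ => hr₀, fun _ => by simp, ?_, fun ε hε => ?_⟩
  · rcases (Nat.lt_succ_iff.1 h.2).eq_or_lt with heq | hlt
    · simp only [heq]; exact hℓ.1.2
    · exact (neg_le_neg (hαdec h ℓ hlt le_rfl).le).trans hℓ.1.2
  · refine hord₁.trans_le (EReal.coe_le_coe_iff.2 (le_min ?_ (by linarith)))
    have := h₂.leading_power_lt hlead
    simp only [Fin.val_zero]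
    linarith
  · set c := min (min c₁ c₂) (min c₁ c') with hc
    have hc0 : 0 < c := lt_min (lt_min h₁.c_pos h₂.c_pos) (lt_min h₁.c_pos hc'0)
    have hc1 : c < 1 := ((min_le_right _ _).trans (min_le_right _ _)).trans_lt hc'
    obtain ⟨X, hX⟩ := h₂.uniform_expansion (le_max_right θ₁ θ₂) hθπ hc0 hc1 hr₀ hℓ.1.1 hlead
      (h₂.remainder_isLittleO hord₂ hℓ) hε
    have hlim := eventually_le_norm h₁.tendsto X
    rw [Nat.cofinite_eq_atTop] at hlim
    filter_upwards [hlim] with n hn z hz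
    have hxn : ‖(lam₁ n : ℂ)‖ = lam₁ n := by
      rw [Complex.norm_real, Real.norm_of_nonneg (hx0 n).le]
    rw [hxn] at hn ⊢
    have hmain := hX (lam₁ n) (hx0 n) hn z hz
    rw [hscale]
    convert hmain using 3
    rw [Finset.sum_range]
    simp
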